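/- Let $\mathrm{QSym}$ be the algebra of quasisymmetric functions over $\mathbb{Q}$ in the ordered variables $x_1, x_2, \dots$, and let $\mathfrak{m}=\bigoplus_{d\ge 1}\mathrm{QSym}_d$ be the ideal of quasisymmetric functions with zero constant term. For a composition $\alpha$ of $n$ let $L_\alpha$ be the fundamental quasisymmetric function, i.e. the sum of the monomial quasisymmetric functions of all compositions of $n$ that refine $\alpha$ ($\alpha$ included). For a matroid $M$ on an $n$-element ground set $E$ put $$F(M)=\sum_{B}\ \sum_{\pi\in\mathcal{L}(P_B)} L_{C(\pi)}\in \mathrm{QSym}.$$ Here $B$ runs over the bases of $M$, and $P_B$ is the poset on $E$ with $e<e'$ if and only if $e\in B$, $e'\notin B$ and $(B\setminus\{e\})\cup\{e'\}$ is a base. The elements of $P_B$ are labeled injectively by positive integers so that $e<_{P_B}e'$ implies that the label of $e$ is larger than the label of $e'$; $\mathcal{L}(P_B)$ is the set of linear extensions of $P_B$, written as words in the labels; and $C(\pi)$ is the composition of $n$ formed by the lengths of the successive increasing runs of $\pi$. (The result does not depend on the labeling.) Write $\overline{F(M)}$ for the image of $F(M)$ in $\mathrm{QSym}/\mathfrak{m}^2$.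 For a partition $\lambda$ of $n$ with $\ell(\lambda)\ge 2$ parts let $M_\lambda$ be the loopless matroid of rank two on $n$ elements whose parallelism classes have the parts of $\lambda$ as their sizes. **Corollary 6.7.** Fix $n \ge 0$, and let $A$ be the semigroup in $(\mathrm{QSym}/\mathfrak{m}^2,+)$ generated by $$S=\{\overline{F(M_\lambda)} : \lambda\vdash n,\ \ell(\lambda)\ge 3\}.$$ Then $$T=\{\overline{F(M_\lambda)} : \lambda\vdash n,\ \ell(\lambda)=3\}$$ is the Hilbert basis of $A$, that is, the minimal generating set of $A$: $T$ generates $A$, and every subset of $\mathrm{QSym}/\mathfrak{m}^2$ that generates $A$ contains $T$. The same holds with semigroups replaced by semigroups with zero (so that $0$ counts as the empty sum). Moreover, distinct partitions $\lambda\vdash n$ with $\ell(\lambda)=3$ give distinct elements $\overline{F(M_\lambda)}$. -/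

import Mathlib

noncomputable section

namespace QuasiSym

/-! ### Quasisymmetric functions over `ℚ`

The variables `x₁ < x₂ < ⋯` are indexed by `ℕ` (in its usual order). -/

/-- The list of nonzero exponents of a monomial, in the order of the variables: for
`d = x_{i₁}^{a₁} ⋯ x_{iₖ}^{aₖ}` with `i₁ < ⋯ < iₖ` and all `aⱼ > 0`, this is `[a₁, …, aₖ]`. -/
def exponents {σ : Type*} [LinearOrder σ] (d : σ →₀ ℕ) : List ℕ :=
  (d.support.sort (· ≤ ·)).map d

/-- A power series is quasisymmetric if it has bounded degree and, for all `a₁, …, aₖ > 0`, the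
coefficients of `x_{i₁}^{a₁} ⋯ x_{iₖ}^{aₖ}` and `x_{j₁}^{a₁} ⋯ x_{jₖ}^{aₖ}` agree
whenever `i₁ < ⋯ < iₖ` and `j₁ < ⋯ < jₖ`. -/
structure IsQuasisymmetric (f : MvPowerSeries ℕ ℚ) : Prop where
  bounded : ∃ N : ℕ, ∀ d : ℕ →₀ ℕ, N < d.degree → MvPowerSeries.coeff d f = 0
  coeff_eq : ∀ d e : ℕ →₀ ℕ, exponents d = exponents e →
    MvPowerSeries.coeff d f = MvPowerSeries.coeff e f

theorem exponents_embDomain {σ τ : Type*} [LinearOrder σ] [LinearOrder τ] (i : σ ↪o τ)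
    (a : σ →₀ ℕ) : exponents (a.embDomain i.toEmbedding) = exponents a := by
  unfold exponents
  rw [Finsupp.support_embDomain]
  have h := Finset.map_sort (f := i.toEmbedding) (s := a.support) (r := (· ≤ ·)) (r' := (· ≤ ·))
    (fun x _ y _ => i.le_iff_le.symm)
  rw [← h, List.map_map]
  refine List.map_congr_left fun x _ => ?_
  exact Finsupp.embDomain_apply_self i.toEmbedding a x

theorem exists_eq_embDomain (d : ℕ →₀ ℕ) (l : List ℕ) (h : exponents d = l) :
    ∃ i : Fin l.length ↪o ℕ,
      d = (Finsupp.equivFunOnFinite.symm l.get).embDomain i.toEmbedding := by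
  have hk : d.support.card = l.length := by
    rw [← h]; simp [exponents]
  refine ⟨d.support.orderEmbOfFin hk, ?_⟩
  ext x
  by_cases hx : x ∈ d.support
  · have hx' : x ∈ Set.range (d.support.orderEmbOfFin hk) := by
      rw [Finset.range_orderEmbOfFin]; exact hx
    obtain ⟨t, rfl⟩ := hx'
    have := Finsupp.embDomain_apply_self (d.support.orderEmbOfFin hk).toEmbedding
      (Finsupp.equivFunOnFinite.symm l.get) t
    refine Eq.trans ?_ this.symm
    subst h
    rw [Finsupp.equivFunOnFinite_symm_apply_apply, List.get_eq_getElem]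
    simp only [exponents, List.getElem_map]
    rfl
  · rw [Finsupp.notMem_support_iff.mp hx, Finsupp.embDomain_of_notMem_range]
    rintro ⟨t, rfl⟩
    exact hx (Finset.orderEmbOfFin_mem d.support hk t)

theorem coeff_embDomain_mul {σ τ : Type*} [DecidableEq σ] [DecidableEq τ] (i : σ ↪ τ)
    (a : σ →₀ ℕ) (f g : MvPowerSeries τ ℚ) :
    MvPowerSeries.coeff (a.embDomain i) (f * g) =
      ∑ p ∈ Finset.HasAntidiagonal.antidiagonal a,
        MvPowerSeries.coeff (p.1.embDomain i) f * MvPowerSeries.coeff (p.2.embDomain i) g := by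
  classical
  rw [MvPowerSeries.coeff_mul]
  symm
  refine Finset.sum_bij (fun p _ => (p.1.embDomain i, p.2.embDomain i)) ?_ ?_ ?_ ?_
  · rintro ⟨b, c⟩ h
    rw [Finset.HasAntidiagonal.mem_antidiagonal] at h ⊢
    simp only at h ⊢
    rw [← h, Finsupp.embDomain_eq_mapDomain, Finsupp.embDomain_eq_mapDomain,
      Finsupp.embDomain_eq_mapDomain, Finsupp.mapDomain_add]
  · rintro ⟨b, c⟩ _ ⟨b', c'⟩ _ h
    simp only [Prod.mk.injEq] at h ⊢
    exact ⟨Finsupp.embDomain_injective i h.1, Finsupp.embDomain_injective i h.2⟩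
  · rintro ⟨b, c⟩ h
    rw [Finset.HasAntidiagonal.mem_antidiagonal] at h
    simp only at h
    have key : ∀ b : τ →₀ ℕ, b ≤ a.embDomain i →
        (b.comapDomain i i.injective.injOn).embDomain i = b := by
      intro b hb
      ext y
      by_cases hy : y ∈ Set.range i
      · obtain ⟨x, rfl⟩ := hy
        rw [Finsupp.embDomain_apply_self]; rfl
      · rw [Finsupp.embDomain_of_notMem_range _ _ _ hy]
        have := hb y
        rw [Finsupp.embDomain_of_notMem_range _ _ _ hy] at this
        exact (Nat.le_zero.mp this).symm
    have hb := key b (h ▸ le_self_add)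
    have hc := key c (h ▸ le_add_self)
    refine ⟨(b.comapDomain i i.injective.injOn, c.comapDomain i i.injective.injOn), ?_, ?_⟩
    · rw [Finset.HasAntidiagonal.mem_antidiagonal]
      apply Finsupp.embDomain_injective i
      rw [← h]
      conv_rhs => rw [← hb, ← hc]
      simp only [Finsupp.embDomain_eq_mapDomain, Finsupp.mapDomain_add]
    · simp only [hb, hc]
  · intros; rfl

theorem IsQuasisymmetric.mul {f g : MvPowerSeries ℕ ℚ} (hf : IsQuasisymmetric f)
    (hg : IsQuasisymmetric g) : IsQuasisymmetric (f * g) where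
  bounded := by
    obtain ⟨N, hN⟩ := hf.bounded
    obtain ⟨K, hK⟩ := hg.bounded
    refine ⟨N + K, fun d hd => ?_⟩
    rw [MvPowerSeries.coeff_mul]
    refine Finset.sum_eq_zero fun p hp => ?_
    rw [Finset.HasAntidiagonal.mem_antidiagonal] at hp
    have hdeg : p.1.degree + p.2.degree = d.degree := by rw [← hp, map_add]
    rcases lt_or_ge N p.1.degree with h | h
    · rw [hN _ h, zero_mul]
    · rw [hK _ (by omega), mul_zero]
  coeff_eq := by
    intro d e h
    obtain ⟨l, hl⟩ : ∃ l, exponents e = l := ⟨_, rfl⟩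
    obtain ⟨i, hi⟩ := exists_eq_embDomain d l (h.trans hl)
    obtain ⟨j, hj⟩ := exists_eq_embDomain e l hl
    rw [hi, hj, coeff_embDomain_mul, coeff_embDomain_mul]
    refine Finset.sum_congr rfl fun p _ => ?_
    rw [hf.coeff_eq _ (p.1.embDomain j.toEmbedding)
        (by rw [exponents_embDomain, exponents_embDomain]),
      hg.coeff_eq _ (p.2.embDomain j.toEmbedding)
        (by rw [exponents_embDomain, exponents_embDomain])]

theorem IsQuasisymmetric.add {f g : MvPowerSeries ℕ ℚ} (hf : IsQuasisymmetric f)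
    (hg : IsQuasisymmetric g) : IsQuasisymmetric (f + g) where
  bounded := by
    obtain ⟨N, hN⟩ := hf.bounded
    obtain ⟨K, hK⟩ := hg.bounded
    refine ⟨max N K, fun d hd => ?_⟩
    rw [map_add, hN d ((le_max_left _ _).trans_lt hd), hK d ((le_max_right _ _).trans_lt hd),
      add_zero]
  coeff_eq d e h := by rw [map_add, map_add, hf.coeff_eq d e h, hg.coeff_eq d e h]

theorem exponents_eq_nil {d : ℕ →₀ ℕ} : exponents d = [] ↔ d = 0 := by
  rw [← List.length_eq_zero_iff]
  simp [exponents]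

theorem isQuasisymmetric_algebraMap (r : ℚ) :
    IsQuasisymmetric (algebraMap ℚ (MvPowerSeries ℕ ℚ) r) where
  bounded := by
    refine ⟨0, fun d hd => ?_⟩
    have hd0 : d ≠ 0 := by rintro rfl; simp at hd
    classical
    rw [MvPowerSeries.algebraMap_apply, Algebra.algebraMap_self, RingHom.id_apply,
      MvPowerSeries.coeff_C, if_neg hd0]
  coeff_eq d e h := by
    classical
    have : d = 0 ↔ e = 0 := by rw [← exponents_eq_nil, ← exponents_eq_nil, h]
    simp only [MvPowerSeries.algebraMap_apply, Algebra.algebraMap_self, RingHom.id_apply,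
      MvPowerSeries.coeff_C, this]

/-- The `ℚ`-algebra of quasisymmetric functions. -/
def QSym : Subalgebra ℚ (MvPowerSeries ℕ ℚ) where
  carrier := {f | IsQuasisymmetric f}
  mul_mem' hf hg := hf.mul hg
  add_mem' hf hg := hf.add hg
  algebraMap_mem' := isQuasisymmetric_algebraMap

/-- The ideal `𝔪 = ⨁_{d ≥ 1} QSym_d` of quasisymmetric functions with zero constant term. -/
def maxIdeal : Ideal QSym :=
  RingHom.ker ((MvPowerSeries.constantCoeff (σ := ℕ) (R := ℚ)).comp QSym.val.toRingHom)

theorem sum_exponents (d : ℕ →₀ ℕ) : (exponents d).sum = d.degree := by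
  have h : ((exponents d : List ℕ) : Multiset ℕ) = d.support.val.map d := by
    rw [exponents, ← Multiset.map_coe, Finset.sort_eq]
  rw [← Multiset.sum_coe, h]
  rfl

/-- The monomial quasisymmetric function
`x^α = ∑_{i₁ < ⋯ < iₖ} x_{i₁}^{α₁} ⋯ x_{iₖ}^{αₖ}` of a composition `α`. -/
def monomialQSym {n : ℕ} (α : Composition n) : QSym :=
  ⟨fun d => if exponents d = α.blocks then 1 else 0, by
    refine ⟨⟨n, fun d hd => if_neg fun h => ?_⟩, fun d e h => ?_⟩
    · rw [← sum_exponents, h, α.blocks_sum] at hd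
      exact lt_irrefl _ hd
    · change (if exponents d = α.blocks then (1 : ℚ) else 0) =
        if exponents e = α.blocks then 1 else 0
      rw [h]⟩

/-- The fundamental quasisymmetric function `L_α`, the sum of `x^β` over all compositions `β` of
the same weight that refine `α`, i.e. whose set of partial sums contains that of `α`. -/
def fundamentalQSym {n : ℕ} (α : Composition n) : QSym :=
  ∑ β : Composition n with α.boundaries ⊆ β.boundaries, monomialQSym β

/-! ### The quasisymmetric function of a labeled poset -/

/-- The composition `C(w)` of `n` given by the lengths of the successive increasing runs of a word
`w` of length `n`: a new run starts exactly at the positions `i` (with `0 < i < n`) at which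
`w (i - 1) > w i`. -/
def runComposition {n : ℕ} (w : Fin n → ℕ) : Composition n :=
  CompositionAsSet.toComposition
    { boundaries := {b : Fin (n + 1) | b = 0 ∨ b = Fin.last n ∨
        ∃ i j : Fin n, (i : ℕ) + 1 = b ∧ (j : ℕ) = b ∧ w j < w i}
      zero_mem := by simp
      getLast_mem := by simp }

open Classical in
/-- The quasisymmetric function `F(P, γ) = ∑_π L_{C(π)}` of a poset `P` on `n` elements with an
injective labeling `γ`. The sum ranges over the linear extensions of `P`, written as bijections
`π` from positions to elements, and `C(π)` is computed from the word of labels. -/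
def posetQSym {n : ℕ} (P : PartialOrder (Fin n)) (γ : Fin n → ℕ) : QSym :=
  ∑ π : Equiv.Perm (Fin n) with ∀ i j : Fin n, P.lt (π i) (π j) → (i : ℕ) < (j : ℕ),
    fundamentalQSym (runComposition fun i => γ (π i))

/-! ### The quasisymmetric function of a matroid -/

/-- The poset `P_B` of a base `B`: `e < e'` iff `e ∈ B`, `e' ∉ B` and `(B \ {e}) ∪ {e'}` is
a base. -/
@[reducible] def basePoset {n : ℕ} (M : Matroid (Fin n)) (B : Finset (Fin n)) : PartialOrder (Fin n) where
  le e e' := e = e' ∨ (e ∈ B ∧ e' ∉ B ∧ M.IsBase (insert e' ((B : Set (Fin n)) \ {e})))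
  lt e e' := e ∈ B ∧ e' ∉ B ∧ M.IsBase (insert e' ((B : Set (Fin n)) \ {e}))
  lt_iff_le_not_ge a b := by
    refine ⟨fun h => ⟨Or.inr h, ?_⟩, ?_⟩
    · rintro (rfl | h')
      · exact h.2.1 h.1
      · exact h.2.1 h'.1
    · rintro ⟨rfl | h, h'⟩
      · exact absurd (Or.inl rfl) h'
      · exact h
  le_refl e := Or.inl rfl
  le_trans := by
    rintro a b c (rfl | h) (rfl | h')
    · exact Or.inl rfl
    · exact Or.inr h'
    · exact Or.inr h
    · exact absurd h'.1 h.2.1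
  le_antisymm := by
    rintro a b (rfl | h) h'
    · rfl
    · rcases h' with h' | h'
      · exact h'.symm
      · exact absurd h'.1 h.2.1

/-- A strict labeling of `P_B` by positive integers: all elements of `B` get larger labels than all
elements of the complement of `B`. The function of a strictly labeled poset does not depend on
which strict labeling is used. -/
def baseLabeling {n : ℕ} (B : Finset (Fin n)) (e : Fin n) : ℕ :=
  if e ∈ B then n + (e : ℕ) + 1 else (e : ℕ) + 1

theorem baseLabeling_injective {n : ℕ} (B : Finset (Fin n)) :
    Function.Injective (baseLabeling B) := by
  intro e e' h
  have := e.isLt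
  have := e'.isLt
  unfold baseLabeling at h
  split_ifs at h <;> (ext; omega)

theorem baseLabeling_strict {n : ℕ} (M : Matroid (Fin n)) (B : Finset (Fin n)) (e e' : Fin n)
    (h : (basePoset M B).lt e e') : baseLabeling B e' < baseLabeling B e := by
  obtain ⟨he, he', -⟩ := h
  have := e'.isLt
  simp only [baseLabeling, he, he', if_true, if_false]
  omega

open Classical in
/-- `F(M) = ∑_B F(P_B)`, summed over the bases of a matroid `M` with ground set `{0, …, n-1}`. -/
def matroidQSym {n : ℕ} (M : Matroid (Fin n)) : QSym :=
  ∑ B : Finset (Fin n) with M.IsBase (SetLike.coe B), posetQSym (basePoset M B) (baseLabeling B)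

/-! ### Loopless matroids of rank two -/

/-- The matroid on `{0, …, n-1}` whose parallelism classes are the consecutive blocks of the
composition `α`: a set is independent iff it has at most two elements, no two of which lie in the
same block. It is loopless, and of rank two as soon as `α` has two parts. -/
def rankTwoMatroid {n : ℕ} (α : Composition n) : Matroid (Fin n) :=
  (IndepMatroid.ofFinite (E := Set.univ) Set.finite_univ
    (fun I => I.ncard ≤ 2 ∧ Set.InjOn α.index I)
    (by simp)
    (fun I J hJ hIJ => ⟨(Set.ncard_le_ncard hIJ J.toFinite).trans hJ.1, hJ.2.mono hIJ⟩)
    (by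
      intro I J hI hJ hIJ
      have hex : ∃ e ∈ J, α.index e ∉ α.index '' I := by
        by_contra! h
        have h1 : (α.index '' J).ncard ≤ (α.index '' I).ncard := by
          refine Set.ncard_le_ncard ?_ (Set.toFinite _)
          rintro _ ⟨e, he, rfl⟩
          exact h e he
        rw [hI.2.ncard_image, hJ.2.ncard_image] at h1
        omega
      obtain ⟨e, he, hne⟩ := hex
      have heI : e ∉ I := fun h => hne ⟨e, h, rfl⟩
      refine ⟨e, he, heI, ?_, ?_⟩
      · rw [Set.ncard_insert_of_notMem heI I.toFinite]
        have := hJ.1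
        omega
      · exact (Set.injOn_insert heI).mpr ⟨hI.2, hne⟩)
    (fun I _ => Set.subset_univ I)).matroid

/-- The parts of a partition in decreasing order, as a composition. -/
def partitionComposition {n : ℕ} (p : n.Partition) : Composition n where
  blocks := p.parts.sort (· ≥ ·)
  blocks_pos h := p.parts_pos (by simpa using h)
  blocks_sum := by
    rw [← Multiset.sum_coe, Multiset.sort_eq, p.parts_sum]

/-- The image of `F(M_λ)` in `QSym / 𝔪²`, where `M_λ` is the loopless matroid of rank two
whose parallelism classes have the sizes `λ₁, λ₂, …`. -/
def partitionQSymMod {n : ℕ} (p : n.Partition) : QSym ⧸ maxIdeal ^ 2 :=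
  Ideal.Quotient.mk (maxIdeal ^ 2) (matroidQSym (rankTwoMatroid (partitionComposition p)))

/-! ### Hilbert bases -/

/-- `T` is the Hilbert basis of the semigroup `A`: it is the minimal generating set of `A`, i.e.
it generates `A` and is contained in every set that generates `A`. -/
def IsHilbertBasis {G : Type*} [AddCommMonoid G] (A : AddSubsemigroup G) (T : Set G) : Prop :=
  IsLeast {B : Set G | AddSubsemigroup.closure B = A} T

/-- The same notion for a semigroup with zero, where zero counts as the empty sum. -/
def IsMonoidHilbertBasis {G : Type*} [AddCommMonoid G] (A : AddSubmonoid G) (T : Set G) : Prop :=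
  IsLeast {B : Set G | AddSubmonoid.closure B = A} T

end QuasiSym

end

/-! Write m_a for the number of parts of λ equal to a. The theorem follows from an additive formula
modulo 𝔪² and a family of linear functionals on QSym/𝔪².

Additive formula. For a base {e, e'}, the strict maps f on its poset with f(e) ≤ f(e') are exactly
those with a strict minimum at e on the class C of e and a strict minimum at e' on the complement of
C. Giving ties weight 1/2 to each side splits F(M_λ) into one contribution per class
(`matroidQSym_rankTwo`), and by symmetry the contribution depends only on |C|. The contributions of
C and of its complement add up to a product of two functions in 𝔪 (`classQSym_add_compl`). So the
class of F(M_λ) is the sum of c(a) over the parts a, where c(a) + c(n - a) = 0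
(`partitionQSymMod_eq`, `classMod_add_classMod`). If λ has parts a, b and others with sum t, then
adding 0 = c(a+b) + c(t) breaks it into the three-part partition (a, b, t) and the partition with a
and b merged; induction shows that T generates (`sum_classMod_mem_closure`).

Functionals. Newton's identities turn the operators "coefficient of x₀^i" into derivations D_a of
QSym (`powerDer_mul`), so the constant term of a commutator of two of them kills 𝔪². On strict
P-partition enumerators D_a removes, up to sign, the lower sets of size a with a unique minimal
element (`powerDer_strictQSym`). When a + b = n, the only such sets for the base {e, e'} whose
complement also has a unique minimal element are the classes of e and e', and the commutator takes
the value (-1)^n ab(m_a - m_b) on F(M_λ) (`bracketFunctional_rankTwo`).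

Since Σ m_a = ℓ(λ) and Σ a m_a = n, a linear combination of these functionals has the value ℓ(λ) - 2
(`excess_partitionQSymMod`). It is 1 on T, hence at least 1 on the whole semigroup, so no element of
T is a sum of two elements of A, and each lies in every generating set. The individual functionals
separate the partitions with three parts (`partitionQSymMod_injOn`). -/

noncomputable section

namespace QuasiSym

open Finset hiding mem_antidiagonal antidiagonal
open Finset.HasAntidiagonal

/-! ### Stripping the first variable -/

/-- The exponent vector `(a, d₀, d₁, …)`. -/
def shiftCons (a : ℕ) (d : ℕ →₀ ℕ) : ℕ →₀ ℕ :=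
  Finsupp.single 0 a + d.embDomain ⟨Nat.succ, Nat.succ_injective⟩

@[simp] theorem shiftCons_zero (a : ℕ) (d : ℕ →₀ ℕ) : shiftCons a d 0 = a := by
  rw [shiftCons, Finsupp.add_apply, Finsupp.embDomain_of_notMem_range]
  · simp
  · rintro ⟨x, hx⟩
    simp at hx

@[simp] theorem shiftCons_succ (a : ℕ) (d : ℕ →₀ ℕ) (k : ℕ) : shiftCons a d (k + 1) = d k := by
  rw [shiftCons, Finsupp.add_apply]
  have := Finsupp.embDomain_apply_self ⟨Nat.succ, Nat.succ_injective⟩ d k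
  simp only [Function.Embedding.coeFn_mk, Nat.succ_eq_add_one] at this
  rw [this]
  simp

theorem shiftCons_inj {a b : ℕ} {d e : ℕ →₀ ℕ} : shiftCons a d = shiftCons b e ↔ a = b ∧ d = e := by
  refine ⟨fun h => ⟨?_, ?_⟩, by rintro ⟨rfl, rfl⟩; rfl⟩
  · simpa using DFunLike.congr_fun h 0
  · ext k
    simpa using DFunLike.congr_fun h (k + 1)

theorem shiftCons_add (a b : ℕ) (d e : ℕ →₀ ℕ) :
    shiftCons (a + b) (d + e) = shiftCons a d + shiftCons b e := by
  ext k
  cases k <;> simp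

theorem exists_eq_shiftCons (d : ℕ →₀ ℕ) : ∃ e, d = shiftCons (d 0) e := by
  refine ⟨d.comapDomain Nat.succ Nat.succ_injective.injOn, ?_⟩
  ext k
  cases k <;> simp

theorem degree_shiftCons (a : ℕ) (d : ℕ →₀ ℕ) : (shiftCons a d).degree = a + d.degree := by
  rw [shiftCons, map_add, Finsupp.degree_single, Finsupp.embDomain_eq_mapDomain,
    Finsupp.degree_mapDomain]

theorem exponents_shiftCons_zero (d : ℕ →₀ ℕ) : exponents (shiftCons 0 d) = exponents d := by
  have := exponents_embDomain (OrderEmbedding.ofStrictMono Nat.succ fun _ _ h => Nat.succ_lt_succ h) d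
  rw [← this, shiftCons, Finsupp.single_zero, zero_add]
  rfl

theorem exponents_shiftCons {a : ℕ} (ha : a ≠ 0) (d : ℕ →₀ ℕ) :
    exponents (shiftCons a d) = a :: exponents d := by
  have hs : (shiftCons a d).support =
      Finset.cons 0 (shiftCons 0 d).support (by simp) := by
    ext k
    cases k <;> simp [ha]
  rw [← exponents_shiftCons_zero d]
  unfold exponents
  rw [hs, Finset.sort_cons _ (by simp), List.map_cons, shiftCons_zero]
  congr 1
  refine List.map_congr_left fun k hk => ?_
  cases k
  · simp at hk
  · simp

theorem exponents_shiftCons_congr (a : ℕ) {d e : ℕ →₀ ℕ} (h : exponents d = exponents e) :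
    exponents (shiftCons a d) = exponents (shiftCons a e) := by
  rcases eq_or_ne a 0 with rfl | ha
  · rw [exponents_shiftCons_zero, exponents_shiftCons_zero, h]
  · rw [exponents_shiftCons ha, exponents_shiftCons ha, h]

/-- The coefficient of `x^d` in a quasisymmetric function. -/
def qcoeff (d : ℕ →₀ ℕ) : QSym →ₗ[ℚ] ℚ :=
  (MvPowerSeries.coeff d).comp QSym.val.toLinearMap

theorem ext_qcoeff {f g : QSym} (h : ∀ d, qcoeff d f = qcoeff d g) : f = g :=
  Subtype.ext (MvPowerSeries.ext h)

theorem qcoeff_mul (d : ℕ →₀ ℕ) (f g : QSym) :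
    qcoeff d (f * g) = ∑ p ∈ antidiagonal d, qcoeff p.1 f * qcoeff p.2 g :=
  MvPowerSeries.coeff_mul d _ _

/-- The coefficient of `x₀^a` in a quasisymmetric function, as a quasisymmetric function of the
remaining variables. -/
def strip (a : ℕ) : QSym →ₗ[ℚ] QSym where
  toFun f := ⟨fun d => qcoeff (shiftCons a d) f, by
    obtain ⟨N, hN⟩ := f.2.bounded
    refine ⟨⟨N, fun d hd => hN _ ?_⟩, fun d e h => f.2.coeff_eq _ _ (exponents_shiftCons_congr a h)⟩
    rw [degree_shiftCons]
    omega⟩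
  map_add' f g := by
    apply ext_qcoeff
    intro d
    exact map_add (qcoeff (shiftCons a d)) f g
  map_smul' r f := by
    apply ext_qcoeff
    intro d
    exact map_smul (qcoeff (shiftCons a d)) r f

theorem qcoeff_strip (a : ℕ) (d : ℕ →₀ ℕ) (f : QSym) :
    qcoeff d (strip a f) = qcoeff (shiftCons a d) f := rfl

@[simp] theorem strip_zero (f : QSym) : strip 0 f = f :=
  ext_qcoeff fun d => f.2.coeff_eq _ _ (exponents_shiftCons_zero d)

theorem sum_antidiagonal_shiftCons (a : ℕ) (d : ℕ →₀ ℕ) (F : (ℕ →₀ ℕ) → (ℕ →₀ ℕ) → ℚ) :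
    ∑ p ∈ antidiagonal (shiftCons a d), F p.1 p.2 =
      ∑ q ∈ antidiagonal a, ∑ p ∈ antidiagonal d, F (shiftCons q.1 p.1) (shiftCons q.2 p.2) := by
  rw [← Finset.sum_product']
  symm
  refine Finset.sum_bij (fun x _ => (shiftCons x.1.1 x.2.1, shiftCons x.1.2 x.2.2)) ?_ ?_ ?_ ?_
  · rintro ⟨⟨i, j⟩, ⟨p, q⟩⟩ h
    simp only [mem_product, mem_antidiagonal] at h ⊢
    rw [← shiftCons_add, h.1, h.2]
  · rintro ⟨⟨i, j⟩, ⟨p, q⟩⟩ _ ⟨⟨i', j'⟩, ⟨p', q'⟩⟩ _ h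
    simp only [Prod.mk.injEq, shiftCons_inj] at h ⊢
    tauto
  · rintro ⟨p, q⟩ h
    obtain ⟨p', hp⟩ := exists_eq_shiftCons p
    obtain ⟨q', hq⟩ := exists_eq_shiftCons q
    rw [mem_antidiagonal] at h
    simp only at h
    rw [hp, hq, ← shiftCons_add, shiftCons_inj] at h
    refine ⟨((p 0, q 0), (p', q')), ?_, ?_⟩
    · simp only [mem_product, mem_antidiagonal]
      exact h
    · simp only [← hp, ← hq]
  · intros; rfl

/-- The exponent of the first variable in a product splits between the factors. So the operators
`strip a` form a divided power sequence, which is what makes the operators obtained from Newton's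
identities primitive, i.e. derivations. -/
theorem strip_mul (a : ℕ) (f g : QSym) :
    strip a (f * g) = ∑ p ∈ antidiagonal a, strip p.1 f * strip p.2 g := by
  apply ext_qcoeff
  intro d
  rw [map_sum, qcoeff_strip, qcoeff_mul,
    sum_antidiagonal_shiftCons a d fun p q => qcoeff p f * qcoeff q g]
  refine Finset.sum_congr rfl fun p _ => ?_
  rw [qcoeff_mul]
  rfl

/-! ### The derivations dual to the noncommutative power sums -/

/-- The operators determined by Newton's identities `∑_{i + j = a} Tᵢ ∘ Dⱼ = a Tₐ`, where `Tᵢ`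
strips a first variable with exponent `i`. -/
def powerDer : ℕ → QSym →ₗ[ℚ] QSym
  | 0 => 0
  | n + 1 => ((n + 1 : ℕ) : ℚ) • strip (n + 1) - ∑ k : Fin n, strip (k + 1) ∘ₗ powerDer (n - k)
termination_by n => n

theorem powerDer_zero : powerDer 0 = 0 := by rw [powerDer]

/-- The recursion defining `powerDer` is this identity solved for its term with i = 0, where `strip
0` is the identity. -/
theorem sum_strip_powerDer (a : ℕ) (f : QSym) :
    ∑ p ∈ antidiagonal a, strip p.1 (powerDer p.2 f) = (a : ℚ) • strip a f := by
  cases a with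
  | zero => simp [powerDer_zero]
  | succ n =>
    rw [Finset.Nat.sum_antidiagonal_eq_sum_range_succ fun i j => strip i (powerDer j f),
      Finset.sum_range_succ, Finset.sum_range_succ', Nat.sub_self, powerDer_zero, strip_zero,
      Nat.sub_zero, powerDer, LinearMap.zero_apply, map_zero, add_zero, LinearMap.sub_apply,
      LinearMap.sum_apply, Fin.sum_univ_eq_sum_range
        fun k => (strip (k + 1) ∘ₗ powerDer (n - k)) f]
    simp

/-- Both sides run over the triples with sum a; the bijection exchanges the roles of the last two
entries. -/
theorem sum_antidiagonal_left_comm {M : Type*} [AddCommMonoid M] (a : ℕ) (F : ℕ → ℕ → ℕ → M) :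
    ∑ p ∈ antidiagonal a, ∑ q ∈ antidiagonal p.1, F q.1 q.2 p.2 =
      ∑ p ∈ antidiagonal a, ∑ q ∈ antidiagonal p.1, F q.1 p.2 q.2 := by
  rw [Finset.sum_sigma', Finset.sum_sigma']
  refine Finset.sum_nbij' (fun x => ⟨(x.2.1 + x.1.2, x.2.2), (x.2.1, x.1.2)⟩)
    (fun x => ⟨(x.2.1 + x.1.2, x.2.2), (x.2.1, x.1.2)⟩) ?_ ?_ ?_ ?_ ?_
  · rintro ⟨⟨i, j⟩, ⟨k, l⟩⟩ h
    simp only [mem_sigma, mem_antidiagonal] at h ⊢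
    exact ⟨by omega, trivial⟩
  · rintro ⟨⟨i, j⟩, ⟨k, l⟩⟩ h
    simp only [mem_sigma, mem_antidiagonal] at h ⊢
    exact ⟨by omega, trivial⟩
  · rintro ⟨⟨i, j⟩, ⟨k, l⟩⟩ h
    simp only [mem_sigma, mem_antidiagonal] at h
    obtain ⟨rfl, rfl⟩ := h
    rfl
  · rintro ⟨⟨i, j⟩, ⟨k, l⟩⟩ h
    simp only [mem_sigma, mem_antidiagonal] at h
    obtain ⟨rfl, rfl⟩ := h
    rfl
  · intros; rfl

/-- Newton's identity acts on the factor f alone while the part of the exponent that falls on g is a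
spectator; hence the weight is the share of f instead of a. -/
theorem sum_strip_powerDer_mul (a : ℕ) (f g : QSym) :
    ∑ p ∈ antidiagonal a, strip p.1 (powerDer p.2 f * g) =
      ∑ p ∈ antidiagonal a, (p.1 : ℚ) • (strip p.1 f * strip p.2 g) := by
  simp only [strip_mul]
  rw [sum_antidiagonal_left_comm a fun i j k => strip i (powerDer k f) * strip j g]
  refine Finset.sum_congr rfl fun p _ => ?_
  rw [← Finset.sum_mul, sum_strip_powerDer, smul_mul_assoc]

/-- The defects Δ_j of the Leibniz rule satisfy Σ T_i Δ_j = 0 over i + j = a, because the weights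
coming from f and from g add up to a. By induction only Δ_a is left in this sum. -/
theorem powerDer_mul (a : ℕ) (f g : QSym) :
    powerDer a (f * g) = powerDer a f * g + f * powerDer a g := by
  induction a using Nat.strong_induction_on generalizing f g with
  | _ a ih =>
    have hsum : ∑ p ∈ antidiagonal a,
        strip p.1 (powerDer p.2 (f * g) - powerDer p.2 f * g - f * powerDer p.2 g) = 0 := by
      simp only [map_sub, Finset.sum_sub_distrib]
      rw [sum_strip_powerDer, sum_strip_powerDer_mul, strip_mul]
      have h2 : ∑ p ∈ antidiagonal a, strip p.1 (f * powerDer p.2 g) =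
          ∑ p ∈ antidiagonal a, (p.2 : ℚ) • (strip p.1 f * strip p.2 g) := by
        simp only [mul_comm f]
        rw [sum_strip_powerDer_mul, ← Finset.Nat.sum_antidiagonal_swap]
        refine Finset.sum_congr rfl fun p _ => ?_
        rw [Prod.fst_swap, Prod.snd_swap, mul_comm]
      rw [h2, Finset.smul_sum, ← Finset.sum_sub_distrib, ← Finset.sum_sub_distrib]
      refine Finset.sum_eq_zero fun p hp => ?_
      rw [mem_antidiagonal] at hp
      rw [← hp, Nat.cast_add, add_smul]
      abel
    rw [Finset.sum_eq_single (0, a)] at hsum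
    · rw [strip_zero, sub_sub, sub_eq_zero] at hsum
      exact hsum
    · rintro ⟨i, j⟩ hp hne
      rw [mem_antidiagonal] at hp
      simp only at hp
      have hj : j < a := by
        rcases Nat.eq_zero_or_pos i with rfl | hi
        · exact absurd (by simp at hp; rw [hp]) hne
        · omega
      simp only
      rw [ih j hj f g, sub_sub, sub_self, map_zero]
    · intro h
      simp at h

/-- The commutator of two of the derivations, followed by taking the constant term. -/
def bracketFunctional (a b : ℕ) : QSym →ₗ[ℚ] ℚ :=
  qcoeff 0 ∘ₗ (powerDer b ∘ₗ powerDer a - powerDer a ∘ₗ powerDer b)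

theorem bracketFunctional_apply (a b : ℕ) (f : QSym) :
    bracketFunctional a b f =
      qcoeff 0 (powerDer b (powerDer a f)) - qcoeff 0 (powerDer a (powerDer b f)) := by
  simp [bracketFunctional]

theorem mem_maxIdeal {f : QSym} : f ∈ maxIdeal ↔ qcoeff 0 f = 0 := Iff.rfl

theorem qcoeff_zero_mul (f g : QSym) : qcoeff 0 (f * g) = qcoeff 0 f * qcoeff 0 g := by
  simp [qcoeff_mul]

/-- For f, g without constant term, only the two mixed products of first derivatives survive in the
constant term of D_b D_a (f g). Their sum is symmetric in a and b, so the commutator cancels it. -/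
theorem bracketFunctional_eq_zero (a b : ℕ) {f : QSym} (hf : f ∈ maxIdeal ^ 2) :
    bracketFunctional a b f = 0 := by
  rw [pow_two] at hf
  induction hf using Submodule.mul_induction_on' with
  | mem_mul_mem f hf g hg =>
    rw [mem_maxIdeal] at hf hg
    rw [bracketFunctional_apply]
    simp only [powerDer_mul, map_add, qcoeff_zero_mul, hf, hg]
    ring
  | add f _ g _ hf hg => rw [map_add, hf, hg, add_zero]

/-! ### Generating functions of weighted maps -/

section Gen

variable {E : Type*}

/-- The exponent vector of the monomial `∏_{x ∈ U} x_{f(x)}`. -/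
def mapWeight (U : Finset E) (f : E → ℕ) : ℕ →₀ ℕ := ∑ x ∈ U, Finsupp.single (f x) 1

theorem mapWeight_apply (U : Finset E) (f : E → ℕ) (k : ℕ) :
    mapWeight U f k = #{x ∈ U | f x = k} := by
  rw [mapWeight, Finsupp.finsetSum_apply, Finset.card_filter]
  refine Finset.sum_congr rfl fun x _ => ?_
  rw [Finsupp.single_apply]

theorem mem_support_mapWeight {U : Finset E} (f : E → ℕ) {x : E} (hx : x ∈ U) :
    f x ∈ (mapWeight U f).support := by
  rw [Finsupp.mem_support_iff, mapWeight_apply, Finset.card_ne_zero]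
  exact ⟨x, by simp [hx]⟩

theorem mapWeight_congr {U : Finset E} {f g : E → ℕ} (h : ∀ x ∈ U, f x = g x) :
    mapWeight U f = mapWeight U g :=
  Finset.sum_congr rfl fun x hx => by rw [h x hx]

theorem degree_mapWeight (U : Finset E) (f : E → ℕ) : (mapWeight U f).degree = #U := by
  rw [mapWeight, map_sum]
  simp

theorem mapWeight_comp (U : Finset E) (φ : ℕ → ℕ) (f : E → ℕ) :
    mapWeight U (φ ∘ f) = (mapWeight U f).mapDomain φ := by
  rw [mapWeight, mapWeight, Finsupp.mapDomain_finsetSum]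
  simp

variable [DecidableEq E]

/-- Choosing A and then X disjoint from A is the same as choosing C = A ∪ X and then A inside C. -/
theorem sum_antidiagonal_powersetCard {M : Type*} [AddCommMonoid M] (U : Finset E) (a : ℕ)
    (F : Finset E → Finset E → M) :
    ∑ p ∈ antidiagonal a, ∑ A ∈ U.powersetCard p.2, ∑ X ∈ (U \ A).powersetCard p.1, F A X =
      ∑ C ∈ U.powersetCard a, ∑ A ∈ C.powerset, F A (C \ A) := by
  have h : ∀ p ∈ antidiagonal a,
      ∑ A ∈ U.powersetCard p.2, ∑ X ∈ (U \ A).powersetCard p.1, F A X =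
        ∑ x ∈ (U.powersetCard p.2).sigma fun A => (U \ A).powersetCard p.1, F x.1 x.2 :=
    fun p _ => Finset.sum_sigma' _ _ _
  rw [Finset.sum_congr rfl h, Finset.sum_sigma', Finset.sum_sigma']
  refine Finset.sum_nbij' (fun x => ⟨x.2.1 ∪ x.2.2, x.2.1⟩)
    (fun y => ⟨(#(y.1 \ y.2), #y.2), ⟨y.2, y.1 \ y.2⟩⟩) ?_ ?_ ?_ ?_ ?_
  · rintro ⟨⟨i, j⟩, ⟨A, X⟩⟩ hx
    simp only [mem_sigma, mem_antidiagonal, mem_powersetCard, mem_powerset] at hx ⊢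
    obtain ⟨rfl, ⟨hA, rfl⟩, hX, rfl⟩ := hx
    have hd : Disjoint A X := (disjoint_sdiff.mono_right hX)
    refine ⟨⟨union_subset hA (hX.trans sdiff_subset), ?_⟩, subset_union_left⟩
    rw [card_union_of_disjoint hd, add_comm]
  · rintro ⟨C, A⟩ hx
    simp only [mem_sigma, mem_antidiagonal, mem_powersetCard, mem_powerset] at hx ⊢
    obtain ⟨⟨hC, rfl⟩, hA⟩ := hx
    exact ⟨card_sdiff_add_card_eq_card hA, ⟨hA.trans hC, trivial⟩,
      sdiff_subset_sdiff hC subset_rfl, trivial⟩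
  · rintro ⟨⟨i, j⟩, ⟨A, X⟩⟩ hx
    simp only [mem_sigma, mem_antidiagonal, mem_powersetCard] at hx
    obtain ⟨rfl, ⟨hA, rfl⟩, hX, rfl⟩ := hx
    have hd : Disjoint A X := (disjoint_sdiff.mono_right hX)
    simp only [union_sdiff_cancel_left hd]
  · rintro ⟨C, A⟩ hx
    simp only [mem_sigma, mem_powersetCard, mem_powerset] at hx
    simp only [union_sdiff_of_subset hx.2]
  · rintro ⟨⟨i, j⟩, ⟨A, X⟩⟩ hx
    simp only [mem_sigma, mem_antidiagonal, mem_powersetCard] at hx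
    obtain ⟨rfl, ⟨hA, rfl⟩, hX, rfl⟩ := hx
    have hd : Disjoint A X := (disjoint_sdiff.mono_right hX)
    simp only [union_sdiff_cancel_left hd]

variable [Fintype E]

/-- The maps `U → ℕ` (extended by zero) whose monomial is `x^d`. -/
def mapsOfWeight (U : Finset E) (d : ℕ →₀ ℕ) : Finset (E → ℕ) :=
  {f ∈ Fintype.piFinset fun x => if x ∈ U then d.support else {0} | mapWeight U f = d}

theorem mem_mapsOfWeight {U : Finset E} {d : ℕ →₀ ℕ} {f : E → ℕ} :
    f ∈ mapsOfWeight U d ↔ (∀ x ∉ U, f x = 0) ∧ mapWeight U f = d := by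
  rw [mapsOfWeight, Finset.mem_filter, Fintype.mem_piFinset]
  refine and_congr_left fun h => ⟨fun H x hx => ?_, fun H x => ?_⟩
  · simpa [hx] using H x
  · split_ifs with hx
    · rw [← h]
      exact mem_support_mapWeight f hx
    · simpa using H x hx

/-- A weight on maps which depends only on the relative order of the values on `U`. -/
def IsOrderInvariant (U : Finset E) (h : (E → ℕ) → ℚ) : Prop :=
  ∀ f g : E → ℕ, (∀ x ∈ U, ∀ y ∈ U, f x < f y ↔ g x < g y) → h f = h g

/-- Both monomials are images of one exponent vector on `Fin k` under increasing embeddings; φ and ψ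
are the resulting mutually inverse relabelings of the variables that occur. -/
theorem exists_transfer {d e : ℕ →₀ ℕ} (h : exponents d = exponents e) :
    ∃ φ ψ : ℕ → ℕ, (∀ k ∈ d.support, ∀ l ∈ d.support, φ k < φ l ↔ k < l) ∧
      (∀ k ∈ d.support, ψ (φ k) = k) ∧ (∀ k ∈ e.support, φ (ψ k) = k) ∧
      d.mapDomain φ = e ∧ e.mapDomain ψ = d := by
  obtain ⟨i, hi⟩ := exists_eq_embDomain d _ h
  obtain ⟨j, hj⟩ := exists_eq_embDomain e _ rfl
  set a := Finsupp.equivFunOnFinite.symm (exponents e).get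
  have key : ∀ i j : Fin (exponents e).length ↪o ℕ,
      (∀ k, Function.extend i j 0 (i k) = j k) ∧
      (a.embDomain i.toEmbedding).mapDomain (Function.extend i j 0) =
        a.embDomain j.toEmbedding := by
    intro i j
    have h1 : ∀ k, Function.extend i j 0 (i k) = j k := fun k =>
      i.injective.extend_apply _ _ _
    refine ⟨h1, ?_⟩
    rw [Finsupp.embDomain_eq_mapDomain, Finsupp.embDomain_eq_mapDomain, ← Finsupp.mapDomain_comp]
    congr 1
    funext k
    exact h1 k
  refine ⟨Function.extend i j 0, Function.extend j i 0, ?_, ?_, ?_, ?_, ?_⟩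
  · intro k hk l hl
    rw [hi, Finsupp.support_embDomain, Finset.mem_map] at hk hl
    obtain ⟨k, _, rfl⟩ := hk
    obtain ⟨l, _, rfl⟩ := hl
    simp only [RelEmbedding.coe_toEmbedding]
    rw [(key i j).1, (key i j).1, i.lt_iff_lt, j.lt_iff_lt]
  · intro k hk
    rw [hi, Finsupp.support_embDomain, Finset.mem_map] at hk
    obtain ⟨k, _, rfl⟩ := hk
    simp only [RelEmbedding.coe_toEmbedding]
    rw [(key i j).1, (key j i).1]
  · intro k hk
    rw [hj, Finsupp.support_embDomain, Finset.mem_map] at hk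
    obtain ⟨k, _, rfl⟩ := hk
    simp only [RelEmbedding.coe_toEmbedding]
    rw [(key j i).1, (key i j).1]
  · exact (congrArg _ hi).trans ((key i j).2.trans hj.symm)
  · exact (congrArg _ hj).trans ((key j i).2.trans hi.symm)

theorem sum_mapsOfWeight_congr {U : Finset E} {h : (E → ℕ) → ℚ} (hh : IsOrderInvariant U h)
    {d e : ℕ →₀ ℕ} (hde : exponents d = exponents e) :
    ∑ f ∈ mapsOfWeight U d, h f = ∑ f ∈ mapsOfWeight U e, h f := by
  obtain ⟨φ, ψ, h1, h2, h3, h4, h5⟩ := exists_transfer hde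
  refine Finset.sum_nbij' (fun f x => if x ∈ U then φ (f x) else 0)
    (fun f x => if x ∈ U then ψ (f x) else 0) ?_ ?_ ?_ ?_ ?_
  · intro f hf
    rw [mem_mapsOfWeight] at hf ⊢
    refine ⟨fun x hx => if_neg hx, ?_⟩
    rw [← h4, ← hf.2, ← mapWeight_comp]
    exact mapWeight_congr fun x hx => if_pos hx
  · intro f hf
    rw [mem_mapsOfWeight] at hf ⊢
    refine ⟨fun x hx => if_neg hx, ?_⟩
    rw [← h5, ← hf.2, ← mapWeight_comp]
    exact mapWeight_congr fun x hx => if_pos hx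
  · intro f hf
    rw [mem_mapsOfWeight] at hf
    funext x
    by_cases hx : x ∈ U
    · simp only [hx, if_true]
      exact h2 _ (hf.2 ▸ mem_support_mapWeight f hx)
    · simp only [hx, if_false, hf.1 x hx]
  · intro f hf
    rw [mem_mapsOfWeight] at hf
    funext x
    by_cases hx : x ∈ U
    · simp only [hx, if_true]
      exact h3 _ (hf.2 ▸ mem_support_mapWeight f hx)
    · simp only [hx, if_false, hf.1 x hx]
  · intro f hf
    rw [mem_mapsOfWeight] at hf
    refine hh _ _ fun x hx y hy => ?_
    simp only [hx, hy, if_true]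
    rw [h1 _ (hf.2 ▸ mem_support_mapWeight f hx) _ (hf.2 ▸ mem_support_mapWeight f hy)]

/-- The generating function `∑_f h(f) ∏_{x ∈ U} x_{f(x)}` over all maps `f : U → ℕ`. -/
def genQSym (U : Finset E) (h : (E → ℕ) → ℚ) (hh : IsOrderInvariant U h) : QSym :=
  ⟨fun d => ∑ f ∈ mapsOfWeight U d, h f, by
    refine ⟨⟨#U, fun d hd => ?_⟩, fun d e hde => sum_mapsOfWeight_congr hh hde⟩
    refine Finset.sum_eq_zero fun f hf => ?_
    rw [mem_mapsOfWeight] at hf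
    rw [← hf.2, degree_mapWeight] at hd
    exact absurd hd (lt_irrefl _)⟩

theorem qcoeff_genQSym {U : Finset E} {h : (E → ℕ) → ℚ} (hh : IsOrderInvariant U h)
    (d : ℕ →₀ ℕ) : qcoeff d (genQSym U h hh) = ∑ f ∈ mapsOfWeight U d, h f := rfl

/-- A is the set where the map takes the value 0, and the remaining values drop by one. Maps are
normalized to vanish off their domain, so the value 0 outside `U \ A` is correct both on A and
outside U. -/
theorem sum_mapsOfWeight_shiftCons (U : Finset E) (h : (E → ℕ) → ℚ) (a : ℕ) (d : ℕ →₀ ℕ) :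
    ∑ f ∈ mapsOfWeight U (shiftCons a d), h f =
      ∑ A ∈ U.powersetCard a, ∑ g ∈ mapsOfWeight (U \ A) d,
        h fun x => if x ∈ U \ A then g x + 1 else 0 := by
  rw [Finset.sum_sigma']
  refine Finset.sum_nbij' (fun f => ⟨{x ∈ U | f x = 0}, fun x => f x - 1⟩)
    (fun p x => if x ∈ U \ p.1 then p.2 x + 1 else 0) ?_ ?_ ?_ ?_ ?_
  · intro f hf
    rw [mem_mapsOfWeight] at hf
    simp only [mem_sigma, mem_powersetCard, mem_mapsOfWeight]
    refine ⟨⟨filter_subset _ _, ?_⟩, fun x hx => ?_, ?_⟩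
    · rw [← mapWeight_apply, hf.2, shiftCons_zero]
    · by_cases hxU : x ∈ U
      · have : f x = 0 := by simpa [hxU] using hx
        rw [this]
      · rw [hf.1 x hxU]
    · ext k
      have := DFunLike.congr_fun hf.2 (k + 1)
      rw [shiftCons_succ, mapWeight_apply] at this
      rw [← this, mapWeight_apply]
      congr 1
      ext x
      simp only [mem_filter, mem_sdiff]
      by_cases hxU : x ∈ U <;> (simp [hxU]; try omega)
  · rintro ⟨A, g⟩ hp
    simp only [mem_sigma, mem_powersetCard, mem_mapsOfWeight] at hp
    obtain ⟨⟨hA, hc⟩, h0, hw⟩ := hp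
    rw [mem_mapsOfWeight]
    refine ⟨fun x hx => if_neg (by simp [hx]), ?_⟩
    ext k
    rw [mapWeight_apply]
    cases k with
    | zero =>
      rw [shiftCons_zero, ← hc]
      congr 1
      ext x
      have := @hA x
      simp only [mem_filter, mem_sdiff]
      by_cases hx : x ∈ A <;> (simp [hx]; try tauto)
    | succ k =>
      rw [shiftCons_succ, ← hw, mapWeight_apply]
      congr 1
      ext x
      simp only [mem_filter, mem_sdiff]
      by_cases hx : x ∈ A <;> by_cases hxU : x ∈ U <;> simp [hx, hxU]
  · intro f hf
    rw [mem_mapsOfWeight] at hf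
    funext x
    by_cases hxU : x ∈ U
    · by_cases hx0 : f x = 0
      · simp [hx0]
      · simp [hxU, hx0]; omega
    · simp [hxU, hf.1 x hxU]
  · rintro ⟨A, g⟩ hp
    simp only [mem_sigma, mem_powersetCard, mem_mapsOfWeight] at hp
    obtain ⟨⟨hA, hc⟩, h0, hw⟩ := hp
    have hA' : ({x ∈ U | (if x ∈ U \ A then g x + 1 else 0) = 0} : Finset E) = A := by
      ext x
      have := @hA x
      simp only [mem_filter, mem_sdiff]
      by_cases hx : x ∈ A <;> (simp [hx]; try tauto)
    simp only [hA']
    congr 1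
    funext x
    by_cases hx : x ∈ U \ A
    · simp [hx]
    · simp [hx, h0 x hx]
  · intro f hf
    rw [mem_mapsOfWeight] at hf
    congr 1
    funext x
    by_cases hxU : x ∈ U
    · by_cases hx0 : f x = 0
      · simp [hx0]
      · simp [hxU, hx0]; omega
    · simp [hxU, hf.1 x hxU]

/-- A map on the disjoint union is a pair of maps; since each vanishes off its own domain, gluing is
pointwise addition. -/
theorem genQSym_mul {U V : Finset E} (hUV : Disjoint U V) {h k : (E → ℕ) → ℚ}
    (hh : IsOrderInvariant U h) (hk : IsOrderInvariant V k)
    (hhk : IsOrderInvariant (U ∪ V) fun f => h f * k f) :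
    genQSym U h hh * genQSym V k hk = genQSym (U ∪ V) (fun f => h f * k f) hhk := by
  apply ext_qcoeff
  intro d
  rw [qcoeff_mul]
  simp only [qcoeff_genQSym, Finset.sum_mul_sum, ← Finset.sum_product']
  rw [Finset.sum_sigma']
  have hnU : ∀ x ∈ V, x ∉ U := fun x hx hx' => Finset.disjoint_left.mp hUV hx' hx
  refine Finset.sum_nbij' (fun p x => p.2.1 x + p.2.2 x)
    (fun f => ⟨(mapWeight U f, mapWeight V f),
      (fun x => if x ∈ U then f x else 0, fun x => if x ∈ V then f x else 0)⟩) ?_ ?_ ?_ ?_ ?_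
  · rintro ⟨⟨p, q⟩, ⟨f, g⟩⟩ hx
    simp only [mem_sigma, mem_antidiagonal, mem_product, mem_mapsOfWeight] at hx
    obtain ⟨rfl, ⟨hf0, rfl⟩, hg0, rfl⟩ := hx
    rw [mem_mapsOfWeight]
    refine ⟨fun x hx => ?_, ?_⟩
    · rw [mem_union, not_or] at hx
      simp only [hf0 x hx.1, hg0 x hx.2]
    · rw [mapWeight, Finset.sum_union hUV]
      congr 1
      · exact mapWeight_congr fun x hx => by simp [hg0 x fun h => hnU x h hx]
      · exact mapWeight_congr fun x hx => by simp [hf0 x (hnU x hx)]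
  · intro f hf
    rw [mem_mapsOfWeight] at hf
    simp only [mem_sigma, mem_antidiagonal, mem_product, mem_mapsOfWeight]
    refine ⟨?_, ⟨fun x hx => if_neg hx, mapWeight_congr fun x hx => if_pos hx⟩,
      fun x hx => if_neg hx, mapWeight_congr fun x hx => if_pos hx⟩
    rw [← hf.2, mapWeight, mapWeight, mapWeight, Finset.sum_union hUV]
  · rintro ⟨⟨p, q⟩, ⟨f, g⟩⟩ hx
    simp only [mem_sigma, mem_antidiagonal, mem_product, mem_mapsOfWeight] at hx
    obtain ⟨rfl, ⟨hf0, rfl⟩, hg0, rfl⟩ := hx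
    have hf : ∀ x ∈ U, f x + g x = f x := fun x hx => by simp [hg0 x fun h => hnU x h hx]
    have hg : ∀ x ∈ V, f x + g x = g x := fun x hx => by simp [hf0 x (hnU x hx)]
    have h1 : (fun x => if x ∈ U then f x + g x else 0) = f := by
      funext x
      split_ifs with hx
      · exact hf x hx
      · exact (hf0 x hx).symm
    have h2 : (fun x => if x ∈ V then f x + g x else 0) = g := by
      funext x
      split_ifs with hx
      · exact hg x hx
      · exact (hg0 x hx).symm
    simp only [h1, h2, mapWeight_congr hf, mapWeight_congr hg]
  · intro f hf
    rw [mem_mapsOfWeight] at hf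
    funext x
    by_cases hxU : x ∈ U
    · simp [hxU, Finset.disjoint_left.mp hUV hxU]
    · by_cases hxV : x ∈ V
      · simp [hxU, hxV]
      · simp [hxU, hxV, hf.1 x (by simp [hxU, hxV])]
  · rintro ⟨⟨p, q⟩, ⟨f, g⟩⟩ hx
    simp only [mem_sigma, mem_antidiagonal, mem_product, mem_mapsOfWeight] at hx
    obtain ⟨rfl, ⟨hf0, rfl⟩, hg0, rfl⟩ := hx
    have hf : ∀ x ∈ U, f x + g x = f x := fun x hx => by simp [hg0 x fun h => hnU x h hx]
    have hg : ∀ x ∈ V, f x + g x = g x := fun x hx => by simp [hf0 x (hnU x hx)]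
    congr 1
    · exact hh _ _ fun x hx y hy => by simp only [hf x hx, hf y hy]
    · exact hk _ _ fun x hx y hy => by simp only [hg x hx, hg y hy]

theorem genQSym_mem_maxIdeal {U : Finset E} (hU : U.Nonempty) {h : (E → ℕ) → ℚ}
    (hh : IsOrderInvariant U h) : genQSym U h hh ∈ maxIdeal := by
  rw [mem_maxIdeal, qcoeff_genQSym]
  refine Finset.sum_eq_zero fun f hf => ?_
  obtain ⟨x, hx⟩ := hU
  have := mem_support_mapWeight f hx
  rw [(mem_mapsOfWeight.mp hf).2] at this
  simp at this

/-! ### Generating functions of strict maps -/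

open Classical in
/-- The indicator of the maps which are strictly monotone on `U` for the relation `r`. -/
def strictIndicator (r : E → E → Prop) (U : Finset E) (f : E → ℕ) : ℚ :=
  if ∀ x ∈ U, ∀ y ∈ U, r x y → f x < f y then 1 else 0

theorem isOrderInvariant_strictIndicator (r : E → E → Prop) (U : Finset E) :
    IsOrderInvariant U (strictIndicator r U) := by
  intro f g h
  unfold strictIndicator
  congr 1
  rw [eq_iff_iff]
  exact forall₂_congr fun x hx => forall₂_congr fun y hy => by rw [h x hx y hy]

/-- The generating function of the strict maps `U → ℕ` for the relation `r`. -/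
def strictQSym (r : E → E → Prop) (U : Finset E) : QSym :=
  genQSym U (strictIndicator r U) (isOrderInvariant_strictIndicator r U)

open Classical in
/-- The indicator of the sets all of whose elements are minimal in `U`. -/
def minimalIndicator (r : E → E → Prop) (U X : Finset E) : ℚ :=
  if ∀ x ∈ X, ∀ y ∈ U, ¬ r y x then 1 else 0

/-- The elements sent to the first variable have nothing strictly below them, and they impose no
condition on the rest. -/
theorem strip_strictQSym (r : E → E → Prop) (U : Finset E) (a : ℕ) :
    strip a (strictQSym r U) =
      ∑ A ∈ U.powersetCard a, minimalIndicator r U A • strictQSym r (U \ A) := by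
  apply ext_qcoeff
  intro d
  rw [map_sum, qcoeff_strip, strictQSym, qcoeff_genQSym, sum_mapsOfWeight_shiftCons]
  refine Finset.sum_congr rfl fun A hA => ?_
  rw [map_smul, strictQSym, qcoeff_genQSym, smul_eq_mul, Finset.mul_sum]
  refine Finset.sum_congr rfl fun g _ => ?_
  unfold strictIndicator minimalIndicator
  rw [ite_zero_mul_ite_zero, one_mul]
  congr 1
  rw [eq_iff_iff]
  have hAU : A ⊆ U := (mem_powersetCard.mp hA).1
  constructor
  · intro H
    refine ⟨fun x hx y hy hr => ?_, fun x hx y hy hr => ?_⟩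
    · have := H y hy x (hAU hx) hr
      simp [hx] at this
    · have := H x (mem_sdiff.mp hx).1 y (mem_sdiff.mp hy).1 hr
      simp only [if_pos hx, if_pos hy] at this
      omega
  · rintro ⟨H1, H2⟩ x hx y hy hr
    have hyA : y ∈ U \ A := mem_sdiff.mpr ⟨hy, fun h => H1 y h x hx hr⟩
    simp only [if_pos hyA]
    split_ifs with hxA
    · have := H2 x hxA y hyA hr
      omega
    · omega

open Classical in
/-- The minimal elements of `A`. -/
def minimalElements (r : E → E → Prop) (A : Finset E) : Finset E :=
  {y ∈ A | ∀ x ∈ A, ¬ r x y}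

theorem mem_minimalElements {r : E → E → Prop} {A : Finset E} {y : E} :
    y ∈ minimalElements r A ↔ y ∈ A ∧ ∀ x ∈ A, ¬ r x y := by
  simp [minimalElements]

open Classical in
/-- The sign `(-1)^{|A| - 1}` if `A` is a lower subset of `U` with a unique minimal element, and
zero otherwise. -/
def rootedSign (r : E → E → Prop) (U A : Finset E) : ℚ :=
  if (∀ y ∈ A, ∀ x ∈ U, r x y → x ∈ A) ∧ #(minimalElements r A) = 1 then (-1) ^ (#A + 1) else 0

/-- This is Newton's identity for strict maps at the level of sets: for fixed C the signed sum over
A vanishes unless C consists of minimal elements. The cancellation comes from a sign-reversing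
involution that toggles one element of C. -/
theorem sum_rootedSign_mul_minimalIndicator {r : E → E → Prop} (hirr : ∀ x, ¬ r x x)
    (htr : ∀ x y z, r x y → r y z → r x z) {U C : Finset E} (hCU : C ⊆ U) :
    ∑ A ∈ C.powerset, rootedSign r U A * minimalIndicator r (U \ A) (C \ A) =
      #C * minimalIndicator r U C := by
  classical
  by_cases hmin : ∀ x ∈ C, ∀ y ∈ U, ¬ r y x
  · have h1 : ∀ A ∈ C.powerset, rootedSign r U A * minimalIndicator r (U \ A) (C \ A) =
        if #A = 1 then 1 else 0 := by
      intro A hA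
      rw [mem_powerset] at hA
      have hm : minimalElements r A = A :=
        filter_true_of_mem fun y hy x hx => hmin y (hA hy) x (hCU (hA hx))
      rw [minimalIndicator, if_pos, mul_one, rootedSign, hm]
      · by_cases hc : #A = 1
        · rw [if_pos ⟨fun y hy x hx hr => absurd hr (hmin y (hA hy) x hx), hc⟩, if_pos hc, hc]
          norm_num
        · rw [if_neg fun h => hc h.2, if_neg hc]
      · exact fun x hx y hy => hmin x (mem_sdiff.mp hx).1 y (mem_sdiff.mp hy).1
    rw [Finset.sum_congr rfl h1, minimalIndicator, if_pos hmin, Finset.sum_boole, mul_one,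
      ← Finset.powersetCard_eq_filter, Finset.card_powersetCard, Nat.choose_one_right]
  · rw [minimalIndicator, if_neg hmin, mul_zero]
    push Not at hmin
    obtain ⟨z₀, hz₀, y₀, hy₀, hr₀⟩ := hmin
    by_cases hlow : ∀ y ∈ C, ∀ x ∈ U, r x y → x ∈ C
    · have : Std.Irrefl (Function.swap r) := ⟨hirr⟩
      have : IsTrans E (Function.swap r) := ⟨fun a b c hab hbc => htr _ _ _ hbc hab⟩
      -- The element to toggle: z is maximal in C (by transitivity) and has y₀ below it.
      obtain ⟨z, ⟨hzC, hyz⟩, hzmax⟩ :=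
        (Finite.wellFounded_of_trans_of_irrefl (Function.swap r)).has_min
          {z | z ∈ C ∧ r y₀ z} ⟨z₀, hz₀, hr₀⟩
      have hzmax' : ∀ x ∈ C, ¬ r z x := fun x hx hr => hzmax x ⟨hx, htr _ _ _ hyz hr⟩ hr
      rw [← Finset.insert_erase hzC, Finset.sum_powerset_insert (Finset.notMem_erase z C),
        ← Finset.sum_add_distrib]
      refine Finset.sum_eq_zero fun A hA => ?_
      rw [mem_powerset] at hA
      rw [Finset.insert_erase hzC]
      have hzA : z ∉ A := fun h => by simpa using hA h
      have hAC : A ⊆ C := hA.trans (erase_subset _ _)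
      -- Toggling z preserves the support: on either side everything below z lies in A, in
      -- particular y₀, so z is never a minimal element of A ∪ {z}; and by maximality no element of
      -- C depends on z.
      have hiff : (((∀ y ∈ A, ∀ x ∈ U, r x y → x ∈ A) ∧ #(minimalElements r A) = 1) ∧
          ∀ x ∈ C \ A, ∀ y ∈ U \ A, ¬ r y x) ↔
          (((∀ y ∈ insert z A, ∀ x ∈ U, r x y → x ∈ insert z A) ∧
            #(minimalElements r (insert z A)) = 1) ∧
          ∀ x ∈ C \ insert z A, ∀ y ∈ U \ insert z A, ¬ r y x) := by
        have hmm : y₀ ∈ A → minimalElements r (insert z A) = minimalElements r A := by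
          intro hy
          ext x
          simp only [minimalElements, mem_filter, mem_insert]
          constructor
          · rintro ⟨rfl | hx, H⟩
            · exact absurd hyz (H y₀ (Or.inr hy))
            · exact ⟨hx, fun w hw => H w (Or.inr hw)⟩
          · rintro ⟨hx, H⟩
            refine ⟨Or.inr hx, ?_⟩
            rintro w (rfl | hw)
            · exact hzmax' x (hAC hx)
            · exact H w hw
        constructor
        · rintro ⟨⟨H1, H2⟩, H3⟩
          have hb : ∀ y ∈ U, r y z → y ∈ A := fun y hy hr => by
            by_contra h
            exact H3 z (mem_sdiff.mpr ⟨hzC, hzA⟩) y (mem_sdiff.mpr ⟨hy, h⟩) hr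
          refine ⟨⟨?_, ?_⟩, ?_⟩
          · intro y hy x hx hr
            rw [mem_insert] at hy ⊢
            rcases hy with rfl | hy
            · exact Or.inr (hb x hx hr)
            · exact Or.inr (H1 y hy x hx hr)
          · rw [hmm (hb y₀ hy₀ hyz)]
            exact H2
          · intro x hx y hy
            simp only [mem_sdiff, mem_insert, not_or] at hx hy
            exact H3 x (mem_sdiff.mpr ⟨hx.1, hx.2.2⟩) y (mem_sdiff.mpr ⟨hy.1, hy.2.2⟩)
        · rintro ⟨⟨H1, H2⟩, H3⟩
          have hb : ∀ y ∈ U, r y z → y ∈ A := fun y hy hr => by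
            rcases mem_insert.mp (H1 z (mem_insert_self _ _) y hy hr) with rfl | h
            · exact absurd hr (hirr _)
            · exact h
          refine ⟨⟨?_, ?_⟩, ?_⟩
          · intro y hy x hx hr
            rcases mem_insert.mp (H1 y (mem_insert_of_mem hy) x hx hr) with rfl | h
            · exact absurd hr (hzmax' y (hAC hy))
            · exact h
          · rw [← hmm (hb y₀ hy₀ hyz)]
            exact H2
          · intro x hx y hy hr
            rw [mem_sdiff] at hx hy
            rcases eq_or_ne x z with rfl | hxz
            · exact hy.2 (hb y hy.1 hr)
            · rcases eq_or_ne y z with rfl | hyz'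
              · exact hzmax' x hx.1 hr
              · exact H3 x (by simp [hx, hxz]) y (by simp [hy, hyz']) hr
      unfold rootedSign minimalIndicator
      rw [ite_zero_mul_ite_zero, ite_zero_mul_ite_zero, mul_one, mul_one]
      by_cases h : ((∀ y ∈ A, ∀ x ∈ U, r x y → x ∈ A) ∧ #(minimalElements r A) = 1) ∧
          ∀ x ∈ C \ A, ∀ y ∈ U \ A, ¬ r y x
      · rw [if_pos h, if_pos (hiff.mp h), card_insert_of_notMem hzA]
        ring
      · rw [if_neg h, if_neg fun h' => h (hiff.mpr h'), add_zero]
    -- Here some y in C has an x outside C below it. If y ∈ A then A is not a lower set; if not, y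
    -- is not minimal in `U \ A`. Every term vanishes.
    · push Not at hlow
      obtain ⟨y, hy, x, hx, hr, hxC⟩ := hlow
      refine Finset.sum_eq_zero fun A hA => ?_
      rw [mem_powerset] at hA
      by_cases hyA : y ∈ A
      · rw [rootedSign, if_neg fun h => hxC (hA (h.1 y hyA x hx hr)), zero_mul]
      · rw [minimalIndicator, if_neg fun h => h y (mem_sdiff.mpr ⟨hy, hyA⟩) x
          (mem_sdiff.mpr ⟨hx, fun h' => hxC (hA h')⟩) hr, mul_zero]

/-- Newton's identities are triangular, so they have only one solution; it suffices that the
right-hand side satisfies them, which is the preceding set identity after grouping by C = A ∪ X. -/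
theorem powerDer_strictQSym {r : E → E → Prop} (hirr : ∀ x, ¬ r x x)
    (htr : ∀ x y z, r x y → r y z → r x z) (a : ℕ) (U : Finset E) :
    powerDer a (strictQSym r U) =
      ∑ A ∈ U.powersetCard a, rootedSign r U A • strictQSym r (U \ A) := by
  induction a using Nat.strong_induction_on with
  | _ a ih =>
    have hsum : ∑ p ∈ antidiagonal a, strip p.1
        (∑ A ∈ U.powersetCard p.2, rootedSign r U A • strictQSym r (U \ A)) =
        ∑ p ∈ antidiagonal a, strip p.1 (powerDer p.2 (strictQSym r U)) := by
      rw [sum_strip_powerDer, strip_strictQSym, Finset.smul_sum]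
      simp only [map_sum, map_smul, strip_strictQSym, Finset.smul_sum, smul_smul]
      rw [sum_antidiagonal_powersetCard U a fun A X =>
        (rootedSign r U A * minimalIndicator r (U \ A) X) • strictQSym r ((U \ A) \ X)]
      refine Finset.sum_congr rfl fun C hC => ?_
      rw [mem_powersetCard] at hC
      have h1 : ∀ A ∈ C.powerset,
          (rootedSign r U A * minimalIndicator r (U \ A) (C \ A)) •
            strictQSym r ((U \ A) \ (C \ A)) =
          (rootedSign r U A * minimalIndicator r (U \ A) (C \ A)) • strictQSym r (U \ C) := by
        intro A hA
        rw [mem_powerset] at hA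
        rw [_root_.sdiff_sdiff_left, sup_eq_union, union_sdiff_of_subset hA]
      rw [Finset.sum_congr rfl h1, ← Finset.sum_smul,
        sum_rootedSign_mul_minimalIndicator hirr htr hC.1, hC.2]
    have hmem : ((0, a) : ℕ × ℕ) ∈ antidiagonal a := by simp
    have hrest : ∑ p ∈ (antidiagonal a).erase (0, a), strip p.1
        (∑ A ∈ U.powersetCard p.2, rootedSign r U A • strictQSym r (U \ A)) =
        ∑ p ∈ (antidiagonal a).erase (0, a), strip p.1 (powerDer p.2 (strictQSym r U)) := by
      refine Finset.sum_congr rfl ?_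
      rintro ⟨i, j⟩ hp
      rw [mem_erase, mem_antidiagonal] at hp
      simp only [ne_eq, Prod.mk.injEq] at hp ⊢
      rw [ih j (by omega)]
    rw [← Finset.add_sum_erase _ _ hmem, ← Finset.add_sum_erase _ _ hmem, strip_zero, strip_zero,
      hrest, add_left_inj] at hsum
    exact hsum.symm

/-- As a + b is the number of elements, the second derivation has to remove exactly what the first
one left over. -/
theorem qcoeff_zero_powerDer_powerDer {r : E → E → Prop} (hirr : ∀ x, ¬ r x x)
    (htr : ∀ x y z, r x y → r y z → r x z) {a b : ℕ} (hab : a + b = Fintype.card E) :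
    qcoeff 0 (powerDer b (powerDer a (strictQSym r univ))) =
      ∑ A ∈ univ.powersetCard a, rootedSign r univ A * rootedSign r Aᶜ Aᶜ := by
  rw [powerDer_strictQSym hirr htr, map_sum, map_sum]
  refine Finset.sum_congr rfl fun A hA => ?_
  rw [mem_powersetCard] at hA
  have hc : #Aᶜ = b := by rw [card_compl]; omega
  rw [map_smul, map_smul, powerDer_strictQSym hirr htr, ← compl_eq_univ_sdiff, ← hc,
    powersetCard_self, sum_singleton, map_smul, sdiff_self, bot_eq_empty, smul_eq_mul, smul_eq_mul]
  have : qcoeff 0 (strictQSym r ∅) = 1 := by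
    rw [strictQSym, qcoeff_genQSym]
    have : mapsOfWeight (∅ : Finset E) 0 = {fun _ => 0} := by
      ext f
      rw [mem_mapsOfWeight, mem_singleton, funext_iff]
      simp [mapWeight]
    rw [this, sum_singleton, strictIndicator, if_pos (by simp)]
  rw [this, mul_one]

end Gen

/-! ### Compositions and sorted words -/

theorem card_filter_index_eq {n : ℕ} (α : Composition n) (p : Fin α.length) :
    #{i | α.index i = p} = α.blocksFun p := by
  have : ({i | α.index i = p} : Finset (Fin n)) = univ.map (α.embedding p).toEmbedding := by
    ext i
    simp only [mem_filter, mem_univ, true_and, Finset.mem_map, RelEmbedding.coe_toEmbedding]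
    rw [eq_comm, ← α.mem_range_embedding_iff']
    rfl
  rw [this, card_map, card_univ, Fintype.card_fin]

theorem index_monotone {n : ℕ} (α : Composition n) : Monotone α.index := by
  intro i j hij
  by_contra h
  rw [not_le] at h
  have h1 : α.sizeUpTo (α.index j).succ ≤ α.sizeUpTo (α.index i) :=
    α.monotone_sizeUpTo (by simpa [Nat.succ_le_iff] using h)
  have := α.lt_sizeUpTo_index_succ j
  have := α.sizeUpTo_index_le i
  rw [Fin.le_def] at hij
  omega

/-- A boundary with value j lies between the positions j - 1 and j, so it is present exactly when
these lie in different blocks. -/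
theorem mem_boundaries_iff {n : ℕ} (α : Composition n) {i j : Fin n} (hij : (i : ℕ) + 1 = j)
    {b : Fin (n + 1)} (hb : (b : ℕ) = j) : b ∈ α.boundaries ↔ α.index i < α.index j := by
  have hi := α.lt_sizeUpTo_index_succ i
  have hi' := α.sizeUpTo_index_le i
  have hj := α.lt_sizeUpTo_index_succ j
  have hj' := α.sizeUpTo_index_le j
  simp only [Composition.boundaries, Finset.mem_map, mem_univ, true_and,
    RelEmbedding.coe_toEmbedding]
  constructor
  · rintro ⟨p, rfl⟩
    replace hb : α.sizeUpTo p = j := hb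
    have h1 : (α.index i : ℕ) < p := by
      by_contra h
      have := α.monotone_sizeUpTo (not_lt.mp h)
      omega
    have h2 : (p : ℕ) < (α.index j).succ := by
      by_contra h
      have := α.monotone_sizeUpTo (not_lt.mp h)
      omega
    rw [Fin.val_succ] at h2
    rw [Fin.lt_def]
    omega
  · intro h
    refine ⟨(α.index j).castSucc, ?_⟩
    have h1 : α.sizeUpTo (α.index i).succ ≤ α.sizeUpTo (α.index j) :=
      α.monotone_sizeUpTo (by simpa [Nat.succ_le_iff] using h)
    ext
    change α.sizeUpTo (α.index j) = b
    omega

theorem runComposition_boundaries_subset {n : ℕ} (w : Fin n → ℕ) (α : Composition n) :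
    (runComposition w).boundaries ⊆ α.boundaries ↔
      ∀ i j : Fin n, (i : ℕ) + 1 = j → w j < w i → α.index i < α.index j := by
  rw [runComposition, CompositionAsSet.toComposition_boundaries]
  constructor
  · intro h i j hij hw
    have hb : (j.castSucc : ℕ) = j := rfl
    rw [← mem_boundaries_iff α hij hb]
    apply h
    simp only [mem_filter, mem_univ, true_and]
    exact Or.inr (Or.inr ⟨i, j, hij, rfl, hw⟩)
  · intro h b hb
    simp only [mem_filter, mem_univ, true_and] at hb
    rcases hb with rfl | rfl | ⟨i, j, hi, hj, hw⟩
    · exact α.toCompositionAsSet.zero_mem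
    · exact α.toCompositionAsSet.getLast_mem
    · exact (mem_boundaries_iff α (hi.trans hj.symm) hj.symm).mpr (h i j (hi.trans hj.symm) hw)

theorem eq_of_monotone_of_mapWeight_eq {n : ℕ} {f g : Fin n → ℕ} (hf : Monotone f)
    (hg : Monotone g) (h : mapWeight univ f = mapWeight univ g) : f = g := by
  apply List.ofFn_injective
  refine List.Perm.eq_of_sortedLE hf.sortedLE_ofFn hg.sortedLE_ofFn ?_
  rw [← Multiset.coe_eq_coe, ← Fin.univ_val_map, ← Fin.univ_val_map]
  ext k
  have := DFunLike.congr_fun h k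
  rw [mapWeight_apply, mapWeight_apply] at this
  rw [Multiset.count_map, Multiset.count_map]
  simp only [eq_comm (a := k)]
  exact this

theorem exists_sorted_map {n : ℕ} (d : ℕ →₀ ℕ) (α : Composition n) (h : exponents d = α.blocks) :
    ∃ s : Fin n → ℕ, Monotone s ∧ mapWeight univ s = d ∧
      ∀ i j, s i < s j ↔ α.index i < α.index j := by
  have hk : d.support.card = α.length := by
    rw [← α.blocks_length, ← h]
    simp [exponents]
  set o := d.support.orderEmbOfFin hk
  have ho : ∀ p, d (o p) = α.blocksFun p := by
    intro p
    rw [Finset.orderEmbOfFin_apply, Composition.blocksFun, List.get_eq_getElem]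
    simp only [← h, exponents, List.getElem_map]
    rfl
  refine ⟨fun i => o (α.index i), fun i j hij => o.monotone (index_monotone α hij), ?_,
    fun i j => o.lt_iff_lt⟩
  ext k
  rw [mapWeight_apply]
  by_cases hkd : k ∈ d.support
  · have : k ∈ Set.range o := by
      rw [Finset.range_orderEmbOfFin]
      exact hkd
    obtain ⟨p, rfl⟩ := this
    rw [ho, ← card_filter_index_eq]
    simp
  · rw [Finsupp.notMem_support_iff.mp hkd, card_eq_zero, filter_eq_empty_iff]
    rintro i - rfl
    exact hkd (Finset.orderEmbOfFin_mem _ _ _)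

theorem strictMono_of_lt_next {n : ℕ} {α : Type*} [Preorder α] {f : Fin n → α}
    (h : ∀ i j : Fin n, (i : ℕ) + 1 = j → f i < f j) : StrictMono f := by
  cases n with
  | zero => exact fun i => i.elim0
  | succ n => exact Fin.strictMono_iff_lt_succ.mpr fun i => h _ _ rfl

/-! ### The fundamental theorem of `P`-partitions -/

theorem sum_strictIndicator {E : Type*} [Fintype E] [DecidableEq E] (r : E → E → Prop) (U : Finset E)
    (S : Finset (E → ℕ)) [DecidablePred fun f : E → ℕ => ∀ x ∈ U, ∀ y ∈ U, r x y → f x < f y] :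
    ∑ f ∈ S, strictIndicator r U f = #{f ∈ S | ∀ x ∈ U, ∀ y ∈ U, r x y → f x < f y} := by
  rw [Finset.card_filter, Nat.cast_sum]
  refine Finset.sum_congr rfl fun f _ => ?_
  unfold strictIndicator
  split_ifs <;> simp

/-- P-partition sorting: π goes to the map s ∘ π⁻¹, and a map f goes back to the permutation that
sorts the elements by value and, among equal values, by label. Strictness of the labeling makes a
relation between elements of equal value impossible on either side. -/
theorem card_linearExtension_eq {n : ℕ} (r : Fin n → Fin n → Prop) {γ : Fin n → ℕ}
    (hγ : Function.Injective γ) (hs : ∀ e e', r e e' → γ e' < γ e) {s : Fin n → ℕ}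
    (hmono : Monotone s) [DecidablePred fun π : Equiv.Perm (Fin n) =>
      (∀ i j : Fin n, r (π i) (π j) → (i : ℕ) < (j : ℕ)) ∧
        ∀ i j : Fin n, (i : ℕ) + 1 = j → γ (π j) < γ (π i) → s i < s j]
    [DecidablePred fun f : Fin n → ℕ => ∀ x ∈ univ, ∀ y ∈ univ, r x y → f x < f y] :
    #{π : Equiv.Perm (Fin n) | (∀ i j : Fin n, r (π i) (π j) → (i : ℕ) < (j : ℕ)) ∧
        ∀ i j : Fin n, (i : ℕ) + 1 = j → γ (π j) < γ (π i) → s i < s j} =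
      #{f ∈ mapsOfWeight univ (mapWeight univ s) |
        ∀ x ∈ univ, ∀ y ∈ univ, r x y → f x < f y} := by
  let key : (Fin n → ℕ) → Fin n → ℕ ×ₗ ℕ := fun f x => toLex (f x, γ x)
  have hinj : ∀ f, Function.Injective (key f) := fun f x y h =>
    hγ (congrArg (fun q => (ofLex q).2) h)
  have hkey : ∀ (f : Fin n → ℕ) x y, key f x < key f y → f x ≤ f y := by
    intro f x y h
    rcases Prod.Lex.toLex_lt_toLex.mp h with h | h
    · exact h.le
    · exact h.1.le
  have hfwd : ∀ π : Equiv.Perm (Fin n),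
      (∀ i j : Fin n, (i : ℕ) + 1 = j → γ (π j) < γ (π i) → s i < s j) →
      StrictMono (key (s ∘ π.symm) ∘ π) := by
    intro π hπ
    refine strictMono_of_lt_next fun i j hij => ?_
    simp only [key, Function.comp_apply, Equiv.symm_apply_apply]
    rw [Prod.Lex.toLex_lt_toLex]
    have hle : s i ≤ s j := hmono (by rw [Fin.le_def]; omega)
    rcases hle.lt_or_eq with h | h
    · exact Or.inl h
    · refine Or.inr ⟨h, ?_⟩
      refine lt_of_le_of_ne (not_lt.mp fun h' => (hπ i j hij h').ne h) fun h' => ?_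
      have := π.injective (hγ h')
      rw [this] at hij
      omega
  have hsort : ∀ f : Fin n → ℕ, StrictMono (key f ∘ Tuple.sort (key f)) := fun f =>
    (Tuple.monotone_sort (key f)).strictMono_of_injective
      ((hinj f).comp (Tuple.sort (key f)).injective)
  -- Sorting f gives a weakly increasing word with the same monomial as s, and there is only one
  -- such word.
  have hcomp : ∀ f : Fin n → ℕ, mapWeight univ f = mapWeight univ s →
      f ∘ Tuple.sort (key f) = s := by
    intro f hf
    refine eq_of_monotone_of_mapWeight_eq (fun i j hij => ?_) hmono ?_
    · rcases hij.lt_or_eq with h | rfl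
      · exact hkey f _ _ (hsort f h)
      · exact le_rfl
    · rw [← hf]
      exact Equiv.sum_comp (Tuple.sort (key f)) fun x => Finsupp.single (f x) 1
  refine Finset.card_nbij' (fun π => s ∘ π.symm) (fun f => Tuple.sort (key f)) ?_ ?_ ?_ ?_
  · intro π hπ
    simp only [coe_filter, Set.mem_ofPred_eq, mem_univ, true_and] at hπ
    simp only [coe_filter, Set.mem_ofPred_eq, mem_mapsOfWeight, mem_univ, true_and, not_true_eq_false,
      false_imp_iff, implies_true, true_imp_iff]
    refine ⟨Equiv.sum_comp π.symm fun x => Finsupp.single (s x) 1, fun x y hxy => ?_⟩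
    obtain ⟨i, rfl⟩ := π.surjective x
    obtain ⟨j, rfl⟩ := π.surjective y
    have hlt : i < j := hπ.1 i j hxy
    rcases Prod.Lex.toLex_lt_toLex.mp (hfwd π hπ.2 hlt) with h | h
    · exact h
    · exact absurd h.2 (hs _ _ hxy).not_gt
  · intro f hf
    simp only [coe_filter, Set.mem_ofPred_eq, mem_mapsOfWeight, mem_univ, true_and, not_true_eq_false,
      false_imp_iff, implies_true, true_imp_iff] at hf
    simp only [coe_filter, Set.mem_ofPred_eq, mem_univ, true_and]
    refine ⟨fun i j hij => ?_, fun i j hij hlt => ?_⟩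
    · exact (hsort f).lt_iff_lt.mp
        (Prod.Lex.toLex_lt_toLex.mpr (Or.inl (hf.2 _ _ hij)) : key f _ < key f _)
    · rw [← hcomp f hf.1]
      have h : i < j := by rw [Fin.lt_def]; omega
      rcases Prod.Lex.toLex_lt_toLex.mp (hsort f h) with h | h
      · exact h
      · exact absurd h.2 hlt.not_gt
  · intro π hπ
    simp only [coe_filter, Set.mem_ofPred_eq, mem_univ, true_and] at hπ
    have := Tuple.unique_monotone (Tuple.monotone_sort (key (s ∘ π.symm))) (hfwd π hπ.2).monotone
    ext i : 1
    exact hinj _ (congrFun this i)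
  · intro f hf
    simp only [coe_filter, Set.mem_ofPred_eq, mem_mapsOfWeight] at hf
    funext x
    have := congrFun (hcomp f hf.1.2) ((Tuple.sort (key f)).symm x)
    simpa using this.symm

theorem qcoeff_fundamentalQSym {n : ℕ} (α : Composition n) (d : ℕ →₀ ℕ) :
    qcoeff d (fundamentalQSym α) =
      ∑ β : Composition n with α.boundaries ⊆ β.boundaries,
        if exponents d = β.blocks then 1 else 0 := by
  rw [fundamentalQSym, map_sum]
  rfl

/-- The function of a strictly labeled poset enumerates the strict maps on the poset. -/
theorem posetQSym_eq_strictQSym {n : ℕ} (P : PartialOrder (Fin n)) {γ : Fin n → ℕ}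
    (hγ : Function.Injective γ) (hs : ∀ e e', P.lt e e' → γ e' < γ e) :
    posetQSym P γ = strictQSym P.lt univ := by
  classical
  apply ext_qcoeff
  intro d
  rw [posetQSym, map_sum, strictQSym, qcoeff_genQSym]
  rw [sum_strictIndicator]
  simp only [qcoeff_fundamentalQSym]
  by_cases hd : d.degree = n
  -- The only composition whose monomial function contains x^d is δ, so the coefficient of x^d in
  -- L_α is 1 or 0 according to whether δ refines α.
  · let δ : Composition n := ⟨exponents d, fun {i} hi => by
      simp only [exponents, List.mem_map, mem_sort, Finsupp.mem_support_iff] at hi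
      obtain ⟨k, hk, rfl⟩ := hi
      omega, by rw [sum_exponents, hd]⟩
    obtain ⟨s, hmono, hw, hidx⟩ := exists_sorted_map d δ rfl
    have hin : ∀ α : Composition n, (∑ β : Composition n with α.boundaries ⊆ β.boundaries,
        if exponents d = β.blocks then (1 : ℚ) else 0) =
        if α.boundaries ⊆ δ.boundaries then 1 else 0 := by
      intro α
      have : ∀ β : Composition n, exponents d = β.blocks ↔ δ = β := fun β =>
        ⟨fun h => Composition.ext h, fun h => h ▸ rfl⟩
      simp only [this]
      rw [Finset.sum_ite_eq]
      simp
    simp only [hin]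
    rw [Finset.sum_boole, Finset.filter_filter]
    simp only [runComposition_boundaries_subset, ← hidx]
    rw [card_linearExtension_eq P.lt hγ hs hmono, hw]
  · rw [Finset.sum_eq_zero, eq_comm, Nat.cast_eq_zero, card_eq_zero, filter_eq_empty_iff]
    · intro f hf
      rw [mem_mapsOfWeight] at hf
      rw [← hf.2, degree_mapWeight, card_univ, Fintype.card_fin] at hd
      exact absurd rfl hd
    · intro π _
      refine Finset.sum_eq_zero fun β _ => if_neg fun h => hd ?_
      rw [← sum_exponents, h, β.blocks_sum]

theorem matroidQSym_eq {n : ℕ} (M : Matroid (Fin n))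
    [DecidablePred fun B : Finset (Fin n) => M.IsBase (SetLike.coe B)] :
    matroidQSym M = ∑ B : Finset (Fin n) with M.IsBase (SetLike.coe B),
      strictQSym (basePoset M B).lt univ := by
  rw [matroidQSym]
  refine Finset.sum_congr (Finset.filter_congr_decidable _ _ _) fun B _ => ?_
  exact posetQSym_eq_strictQSym _ (baseLabeling_injective B) (baseLabeling_strict M B)

/-! ### Bases of loopless matroids of rank two -/

theorem rankTwoMatroid_indep {n : ℕ} (α : Composition n) (I : Set (Fin n)) :
    (rankTwoMatroid α).Indep I ↔ I.ncard ≤ 2 ∧ Set.InjOn α.index I := Iff.rfl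

theorem exists_index_ne {n : ℕ} {α : Composition n} (hα : 2 ≤ α.length) :
    ∃ e e', α.index e ≠ α.index e' := by
  have hp : ∀ p, ∃ i, α.index i = p := fun p =>
    ⟨α.embedding p ⟨0, α.one_le_blocksFun p⟩, α.index_embedding p _⟩
  obtain ⟨e, he⟩ := hp ⟨0, by omega⟩
  obtain ⟨e', he'⟩ := hp ⟨1, by omega⟩
  exact ⟨e, e', by rw [he, he']; simp⟩

theorem rankTwoMatroid_indep_pair {n : ℕ} (α : Composition n) {e e' : Fin n}
    (h : α.index e ≠ α.index e') : (rankTwoMatroid α).Indep {e, e'} := by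
  refine (rankTwoMatroid_indep α _).mpr ⟨(Set.ncard_insert_le e {e'}).trans (by simp), ?_⟩
  rintro x (rfl | rfl) y (rfl | rfl) hxy
  · rfl
  · exact absurd hxy h
  · exact absurd hxy.symm h
  · rfl

/-- With two blocks there is an independent pair across blocks. Such a pair is maximal because
independent sets have at most two elements, and equicardinality of bases excludes anything else. -/
theorem rankTwoMatroid_isBase {n : ℕ} {α : Composition n} (hα : 2 ≤ α.length) (B : Set (Fin n)) :
    (rankTwoMatroid α).IsBase B ↔ ∃ e e', α.index e ≠ α.index e' ∧ B = {e, e'} := by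
  have hpair : ∀ e e', α.index e ≠ α.index e' → (rankTwoMatroid α).IsBase {e, e'} := by
    intro e e' h
    obtain ⟨B', hB', hsub⟩ := (rankTwoMatroid_indep_pair α h).exists_isBase_superset
    have hne : e ≠ e' := fun h' => h (congrArg _ h')
    have := ((rankTwoMatroid_indep α B').mp hB'.indep).1
    have hcard : B'.ncard ≤ ({e, e'} : Set (Fin n)).ncard := by
      rw [Set.ncard_pair hne]
      exact this
    rw [Set.eq_of_subset_of_ncard_le hsub hcard B'.toFinite]
    exact hB'
  constructor
  · intro hB
    obtain ⟨e, e', h⟩ := exists_index_ne hα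
    have hne : e ≠ e' := fun h' => h (congrArg _ h')
    have hc : B.ncard = 2 := by
      rw [hB.ncard_eq_ncard_of_isBase (hpair e e' h), Set.ncard_pair hne]
    obtain ⟨x, y, hxy, rfl⟩ := Set.ncard_eq_two.mp hc
    refine ⟨x, y, fun h' => hxy ?_, rfl⟩
    exact ((rankTwoMatroid_indep α _).mp hB.indep).2 (by simp) (by simp) h'
  · rintro ⟨e, e', h, rfl⟩
    exact hpair e e' h

theorem rankTwoMatroid_isBase_pair {n : ℕ} {α : Composition n} (hα : 2 ≤ α.length) (x y : Fin n) :
    (rankTwoMatroid α).IsBase {x, y} ↔ α.index x ≠ α.index y := by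
  rw [rankTwoMatroid_isBase hα]
  constructor
  · rintro ⟨e, e', h, heq⟩
    rcases Set.pair_eq_pair_iff.mp heq with ⟨rfl, rfl⟩ | ⟨rfl, rfl⟩
    · exact h
    · exact h.symm
  · exact fun h => ⟨x, y, h, rfl⟩

/-! ### The posets of the bases of a set with an equivalence relation -/

section Pairs

variable {E ι : Type*}

/-- The strict order of the poset `P_B` for the base `B = {e, e'}` of the rank two matroid whose
parallelism classes are the fibers of `c`. -/
def pairRel (c : E → ι) (e e' x y : E) : Prop :=
  y ≠ e ∧ y ≠ e' ∧ ((x = e ∧ c y ≠ c e') ∨ (x = e' ∧ c y ≠ c e))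

theorem pairRel_comm (c : E → ι) (e e' : E) : pairRel c e e' = pairRel c e' e := by
  funext x y
  unfold pairRel
  rw [eq_iff_iff]
  tauto

theorem pairRel_irrefl (c : E → ι) (e e' x : E) : ¬ pairRel c e e' x x := by
  rintro ⟨h, h', ⟨h1, -⟩ | ⟨h1, -⟩⟩
  · exact h h1
  · exact h' h1

/-- Vacuous: the elements on top of a relation lie outside {e, e'}, the ones at the bottom lie
inside. -/
theorem pairRel_trans (c : E → ι) (e e' x y z : E) (h : pairRel c e e' x y)
    (h' : pairRel c e e' y z) : pairRel c e e' x z := by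
  rcases h'.2.2 with ⟨h1, -⟩ | ⟨h1, -⟩
  · exact absurd h1 h.1
  · exact absurd h1 h.2.1

theorem mem_minimalElements_of_left [Fintype E] [DecidableEq E] {c : E → ι} {e e' : E}
    {A : Finset E} (h : e ∈ A) :
    e ∈ minimalElements (pairRel c e e') A :=
  mem_minimalElements.mpr ⟨h, fun _ _ hr => hr.1 rfl⟩

variable [Fintype E] [DecidableEq ι]

/-- The ordered pairs of elements in different fibers of `c`. -/
def crossPairs (c : E → ι) : Finset (E × E) := {p | c p.1 ≠ c p.2}

theorem mem_crossPairs {c : E → ι} {p : E × E} : p ∈ crossPairs c ↔ c p.1 ≠ c p.2 := by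
  simp [crossPairs]

theorem sum_crossPairs {M : Type*} [AddCommMonoid M] (c : E → ι) (F : E × E → M) :
    ∑ p ∈ crossPairs c, F p = ∑ e, ∑ e' with c e' ≠ c e, F (e, e') := by
  rw [crossPairs, Finset.sum_filter, ← Finset.univ_product_univ, Finset.sum_product]
  refine Finset.sum_congr rfl fun e _ => ?_
  rw [Finset.sum_filter]
  simp only [ne_comm]

theorem sum_crossPairs_swap {M : Type*} [AddCommMonoid M] (c : E → ι) (F : E × E → M) :
    ∑ p ∈ crossPairs c, F p.swap = ∑ p ∈ crossPairs c, F p := by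
  refine Finset.sum_nbij' Prod.swap Prod.swap ?_ ?_ ?_ ?_ ?_
  · intro p hp
    exact mem_crossPairs.mpr (mem_crossPairs.mp hp).symm
  · intro p hp
    exact mem_crossPairs.mpr (mem_crossPairs.mp hp).symm
  all_goals intros; simp

/-- The fiber of `c` through `e`. -/
def fiberOf (c : E → ι) (e : E) : Finset E := {x | c x = c e}

theorem mem_fiberOf {c : E → ι} {e x : E} : x ∈ fiberOf c e ↔ c x = c e := by
  simp [fiberOf]

variable [DecidableEq E]

theorem sum_crossPairs_pair {M : Type*} [AddCommMonoid M] (c : E → ι) (Φ : Finset E → M)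
    (S : Finset (Finset E)) (hS : ∀ B, B ∈ S ↔ ∃ e e', c e ≠ c e' ∧ B = {e, e'}) :
    ∑ p ∈ crossPairs c, Φ {p.1, p.2} = 2 • ∑ B ∈ S, Φ B := by
  rw [← Finset.sum_fiberwise_of_maps_to (s := crossPairs c) (t := S) (g := fun p => {p.1, p.2}),
    ← Finset.sum_nsmul]
  · refine Finset.sum_congr rfl fun B hB => ?_
    obtain ⟨e, e', h, rfl⟩ := (hS B).mp hB
    have hne : e ≠ e' := fun h' => h (congrArg _ h')
    have hfib : ({p ∈ crossPairs c | ({p.1, p.2} : Finset E) = {e, e'}} : Finset (E × E)) =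
        {(e, e'), (e', e)} := by
      ext ⟨x, y⟩
      simp only [mem_filter, mem_crossPairs, mem_insert, mem_singleton, Prod.mk.injEq]
      constructor
      · rintro ⟨-, hxy⟩
        rw [← Finset.coe_inj] at hxy
        push_cast at hxy
        exact Set.pair_eq_pair_iff.mp hxy
      · rintro (⟨rfl, rfl⟩ | ⟨rfl, rfl⟩)
        · exact ⟨h, rfl⟩
        · exact ⟨h.symm, Finset.pair_comm _ _⟩
    rw [Finset.sum_congr rfl (g := fun _ => Φ {e, e'}) fun p hp => by
      rw [(mem_filter.mp hp).2], hfib, Finset.sum_const, Finset.card_pair]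
    simp [hne]
  · intro p hp
    exact (hS _).mpr ⟨p.1, p.2, mem_crossPairs.mp hp, rfl⟩

/-! ### Evaluation of the iterated derivations -/

/-- An element of A outside the class of e would have e' below it, forcing e' into A. An element of
the class of e missing from A has only e available below it, and e is in A; so it would be a second
minimal element of the complement, next to e'. -/
theorem eq_fiberOf_of_lower {c : E → ι} {e e' : E} (hne : c e ≠ c e') {A : Finset E} (he : e ∈ A)
    (he' : e' ∉ A) (hlow : ∀ y ∈ A, ∀ x ∈ univ, pairRel c e e' x y → x ∈ A)
    (hmin : #(minimalElements (pairRel c e e') Aᶜ) = 1) : A = fiberOf c e := by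
  have hsub : A ⊆ fiberOf c e := by
    intro x hx
    rw [mem_fiberOf]
    by_contra hcx
    have hxe : x ≠ e := fun h => hcx (congrArg c h)
    have hxe' : x ≠ e' := fun h => he' (h ▸ hx)
    exact he' (hlow x hx e' (mem_univ _) ⟨hxe, hxe', Or.inr ⟨rfl, hcx⟩⟩)
  refine hsub.antisymm fun x hx => ?_
  rw [mem_fiberOf] at hx
  by_contra hxA
  obtain ⟨m, hm⟩ := card_eq_one.mp hmin
  have h1 : e' ∈ minimalElements (pairRel c e e') Aᶜ := by
    rw [pairRel_comm]
    exact mem_minimalElements_of_left (mem_compl.mpr he')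
  have h2 : x ∈ minimalElements (pairRel c e e') Aᶜ := by
    refine mem_minimalElements.mpr ⟨mem_compl.mpr hxA, fun y hy hr => ?_⟩
    rcases hr.2.2 with ⟨rfl, -⟩ | ⟨-, h⟩
    · exact mem_compl.mp hy he
    · exact h hx
  rw [hm, mem_singleton] at h1 h2
  exact hne (by rw [← hx, h2, ← h1])

theorem lower_fiberOf {c : E → ι} {e e' : E} (hne : c e ≠ c e') :
    (∀ y ∈ fiberOf c e, ∀ x ∈ univ, pairRel c e e' x y → x ∈ fiberOf c e) ∧
      minimalElements (pairRel c e e') (fiberOf c e) = {e} ∧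
      minimalElements (pairRel c e e') (fiberOf c e)ᶜ = {e'} := by
  refine ⟨?_, ?_, ?_⟩
  · rintro y hy x - ⟨-, -, ⟨rfl, -⟩ | ⟨-, h⟩⟩
    · exact mem_fiberOf.mpr rfl
    · exact absurd (mem_fiberOf.mp hy) h
  · ext x
    rw [mem_singleton]
    constructor
    · intro hx
      obtain ⟨hx, H⟩ := mem_minimalElements.mp hx
      rw [mem_fiberOf] at hx
      by_contra hxe
      exact H e (mem_fiberOf.mpr rfl) ⟨hxe, fun h => hne (by rw [← hx, h]),
        Or.inl ⟨rfl, by rwa [hx]⟩⟩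
    · rintro rfl
      exact mem_minimalElements_of_left (mem_fiberOf.mpr rfl)
  · ext x
    have he' : e' ∈ (fiberOf c e)ᶜ := by
      rw [mem_compl, mem_fiberOf]
      exact hne.symm
    rw [mem_singleton]
    constructor
    · intro hx
      obtain ⟨hx, H⟩ := mem_minimalElements.mp hx
      rw [mem_compl, mem_fiberOf] at hx
      by_contra hxe
      exact H e' he' ⟨fun h => hx (congrArg c h), hxe, Or.inr ⟨rfl, hx⟩⟩
    · rintro rfl
      rw [pairRel_comm]
      exact mem_minimalElements_of_left he'

/-- Both e and e' are minimal wherever they occur, so A cannot contain both. It cannot avoid both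
either, because every other element has one of them below it. The remaining two cases are exchanged
by swapping e and e'. -/
theorem rooted_iff_eq_fiberOf {c : E → ι} {e e' : E} (hne : c e ≠ c e') (A : Finset E) :
    (((∀ y ∈ A, ∀ x ∈ univ, pairRel c e e' x y → x ∈ A) ∧
      #(minimalElements (pairRel c e e') A) = 1) ∧
      #(minimalElements (pairRel c e e') Aᶜ) = 1) ↔ A = fiberOf c e ∨ A = fiberOf c e' := by
  constructor
  · rintro ⟨⟨hlow, hA⟩, hA'⟩
    by_cases he : e ∈ A <;> by_cases he' : e' ∈ A
    · obtain ⟨m, hm⟩ := card_eq_one.mp hA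
      have h1 := mem_minimalElements_of_left (c := c) (e' := e') he
      have h2 := mem_minimalElements_of_left (c := c) (e' := e) he'
      rw [pairRel_comm, hm, mem_singleton] at h2
      rw [hm, mem_singleton] at h1
      exact absurd (by rw [h1, h2]) hne
    · exact Or.inl (eq_fiberOf_of_lower hne he he' hlow hA')
    · rw [pairRel_comm] at hlow hA'
      exact Or.inr (eq_fiberOf_of_lower hne.symm he' he hlow hA')
    · obtain ⟨m, hm⟩ := card_eq_one.mp hA
      have hmA : m ∈ A := (mem_minimalElements.mp (hm ▸ mem_singleton_self m)).1
      have hme : m ≠ e := fun h => he (h ▸ hmA)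
      have hme' : m ≠ e' := fun h => he' (h ▸ hmA)
      by_cases hc : c m = c e'
      · exact absurd (hlow m hmA e' (mem_univ _)
          ⟨hme, hme', Or.inr ⟨rfl, by rw [hc]; exact hne.symm⟩⟩) he'
      · exact absurd (hlow m hmA e (mem_univ _) ⟨hme, hme', Or.inl ⟨rfl, hc⟩⟩) he
  · rintro (rfl | rfl)
    · obtain ⟨h1, h2, h3⟩ := lower_fiberOf hne
      rw [h2, h3]
      exact ⟨⟨h1, card_singleton _⟩, card_singleton _⟩
    · obtain ⟨h1, h2, h3⟩ := lower_fiberOf hne.symm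
      rw [pairRel_comm, h2, h3]
      exact ⟨⟨h1, card_singleton _⟩, card_singleton _⟩

theorem qcoeff_zero_powerDer_pairRel {c : E → ι} {e e' : E} (hne : c e ≠ c e') {a b : ℕ}
    (hab : a + b = Fintype.card E) :
    qcoeff 0 (powerDer b (powerDer a (strictQSym (pairRel c e e') univ))) =
      (-1) ^ Fintype.card E *
        ((if #(fiberOf c e) = a then 1 else 0) + if #(fiberOf c e') = a then 1 else 0) := by
  rw [qcoeff_zero_powerDer_powerDer (pairRel_irrefl c e e') (pairRel_trans c e e') hab]
  have hterm : ∀ A ∈ univ.powersetCard a,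
      rootedSign (pairRel c e e') univ A * rootedSign (pairRel c e e') Aᶜ Aᶜ =
        (if A = fiberOf c e then (-1) ^ Fintype.card E else 0) +
          if A = fiberOf c e' then (-1) ^ Fintype.card E else 0 := by
    intro A hA
    have hA := (mem_powersetCard.mp hA).2
    have hA' : #Aᶜ = b := by rw [card_compl]; omega
    unfold rootedSign
    rw [ite_zero_mul_ite_zero]
    -- The signs (-1)^(a-1) and (-1)^(b-1) multiply to (-1)^n, whatever a and b are.
    have hsign : ((-1 : ℚ) ^ (#A + 1) * (-1) ^ (#Aᶜ + 1)) = (-1) ^ Fintype.card E := by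
      rw [hA, hA', ← pow_add, ← hab, show a + 1 + (b + 1) = a + b + 2 by ring, pow_add]
      norm_num
    rw [hsign]
    have hcond : (((∀ y ∈ A, ∀ x ∈ univ, pairRel c e e' x y → x ∈ A) ∧
        #(minimalElements (pairRel c e e') A) = 1) ∧
        (∀ y ∈ Aᶜ, ∀ x ∈ Aᶜ, pairRel c e e' x y → x ∈ Aᶜ) ∧
        #(minimalElements (pairRel c e e') Aᶜ) = 1) ↔ A = fiberOf c e ∨ A = fiberOf c e' := by
      rw [← rooted_iff_eq_fiberOf hne A]
      exact and_congr_right fun _ => and_iff_right fun _ _ _ hx _ => hx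
    have hdiff : fiberOf c e ≠ fiberOf c e' := fun h =>
      hne (mem_fiberOf.mp (h ▸ mem_fiberOf.mpr rfl : e ∈ fiberOf c e'))
    by_cases h1 : A = fiberOf c e
    · rw [if_pos (hcond.mpr (Or.inl h1)), if_pos h1, if_neg fun h2 => hdiff (h1 ▸ h2), add_zero]
    · by_cases h2 : A = fiberOf c e'
      · rw [if_pos (hcond.mpr (Or.inr h2)), if_neg h1, if_pos h2, zero_add]
      · rw [if_neg fun h => (hcond.mp h).elim h1 h2, if_neg h1, if_neg h2, add_zero]
  rw [Finset.sum_congr rfl hterm, Finset.sum_add_distrib, Finset.sum_ite_eq', Finset.sum_ite_eq']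
  simp only [mem_powersetCard, subset_univ, true_and]
  split_ifs <;> ring

/-- Swapping the pair identifies the contributions of its two entries, whence the 2. An element
whose class has size a is the first entry of n - a = b pairs. -/
theorem sum_crossPairs_powerDer (c : E → ι) {a b : ℕ} (hab : a + b = Fintype.card E) :
    ∑ p ∈ crossPairs c,
        qcoeff 0 (powerDer b (powerDer a (strictQSym (pairRel c p.1 p.2) univ))) =
      2 * ((-1) ^ Fintype.card E * b * #{e | #(fiberOf c e) = a}) := by
  rw [Finset.sum_congr rfl fun p hp =>
      qcoeff_zero_powerDer_pairRel (mem_crossPairs.mp hp) hab, ← Finset.mul_sum,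
    Finset.sum_add_distrib]
  have h2 := sum_crossPairs_swap c fun p => if #(fiberOf c p.1) = a then (1 : ℚ) else 0
  simp only [Prod.fst_swap] at h2
  have h1 : ∑ p ∈ crossPairs c, (if #(fiberOf c p.1) = a then (1 : ℚ) else 0) =
      b * #{e | #(fiberOf c e) = a} := by
    rw [sum_crossPairs, Finset.card_filter, Nat.cast_sum, Finset.mul_sum]
    refine Finset.sum_congr rfl fun e _ => ?_
    change (∑ _e' with c _e' ≠ c e, if #(fiberOf c e) = a then (1 : ℚ) else 0) = _
    rw [Finset.sum_const (if #(fiberOf c e) = a then (1 : ℚ) else 0), nsmul_eq_mul]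
    split_ifs with h
    · have : ({e' | c e' ≠ c e} : Finset E) = (fiberOf c e)ᶜ := by
        ext x
        simp [mem_fiberOf]
      have hb : #(fiberOf c e)ᶜ = b := by rw [card_compl]; omega
      rw [this, hb]
      simp
    · simp
  rw [h2, h1]
  ring

end Pairs

/-! ### The function of a rank two matroid -/

theorem basePoset_rankTwoMatroid {n : ℕ} {α : Composition n} (hα : 2 ≤ α.length) {e e' : Fin n}
    (h : α.index e ≠ α.index e') :
    (basePoset (rankTwoMatroid α) {e, e'}).lt = pairRel α.index e e' := by
  have hne : e ≠ e' := fun h' => h (congrArg _ h')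
  funext x y
  rw [eq_iff_iff]
  change (x ∈ ({e, e'} : Finset (Fin n)) ∧ y ∉ ({e, e'} : Finset (Fin n)) ∧
    (rankTwoMatroid α).IsBase (insert y ((({e, e'} : Finset (Fin n)) : Set (Fin n)) \ {x}))) ↔ _
  have h1 : (({e, e'} : Finset (Fin n)) : Set (Fin n)) \ {e} = {e'} := by
    ext z
    simp only [coe_insert, coe_singleton, Set.mem_sdiff, Set.mem_insert_iff, Set.mem_singleton_iff]
    constructor
    · tauto
    · rintro rfl
      exact ⟨Or.inr rfl, hne.symm⟩
  have h2 : (({e, e'} : Finset (Fin n)) : Set (Fin n)) \ {e'} = {e} := by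
    ext z
    simp only [coe_insert, coe_singleton, Set.mem_sdiff, Set.mem_insert_iff, Set.mem_singleton_iff]
    constructor
    · tauto
    · rintro rfl
      exact ⟨Or.inl rfl, hne⟩
  unfold pairRel
  simp only [mem_insert, mem_singleton, not_or]
  constructor
  · rintro ⟨rfl | rfl, ⟨hy, hy'⟩, hb⟩
    · rw [h1, rankTwoMatroid_isBase_pair hα] at hb
      exact ⟨hy, hy', Or.inl ⟨rfl, hb⟩⟩
    · rw [h2, rankTwoMatroid_isBase_pair hα] at hb
      exact ⟨hy, hy', Or.inr ⟨rfl, hb⟩⟩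
  · rintro ⟨hy, hy', ⟨rfl, hb⟩ | ⟨rfl, hb⟩⟩
    · refine ⟨Or.inl rfl, ⟨hy, hy'⟩, ?_⟩
      rw [h1, rankTwoMatroid_isBase_pair hα]
      exact hb
    · refine ⟨Or.inr rfl, ⟨hy, hy'⟩, ?_⟩
      rw [h2, rankTwoMatroid_isBase_pair hα]
      exact hb

/-- Ordered pairs avoid choosing which element of a base comes first, at the price of counting every
base twice. -/
theorem two_nsmul_matroidQSym {n : ℕ} {α : Composition n} (hα : 2 ≤ α.length) :
    2 • matroidQSym (rankTwoMatroid α) =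
      ∑ p ∈ crossPairs α.index, strictQSym (pairRel α.index p.1 p.2) univ := by
  classical
  rw [matroidQSym_eq, ← sum_crossPairs_pair α.index
    fun B => strictQSym (basePoset (rankTwoMatroid α) B).lt univ]
  · refine Finset.sum_congr rfl fun p hp => ?_
    rw [basePoset_rankTwoMatroid hα (mem_crossPairs.mp hp)]
  · intro B
    simp only [mem_filter, mem_univ, true_and]
    rw [rankTwoMatroid_isBase hα]
    refine exists₂_congr fun e e' => and_congr_right fun _ => ?_
    rw [← Finset.coe_inj]
    simp

theorem card_fiberOf_index {n : ℕ} (α : Composition n) (e : Fin n) :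
    #(fiberOf α.index e) = α.blocksFun (α.index e) :=
  card_filter_index_eq α _

theorem sum_index {n : ℕ} {M : Type*} [AddCommMonoid M] (α : Composition n)
    (F : Fin n → M) : ∑ e, F e = ∑ p, ∑ e with α.index e = p, F e :=
  (Finset.sum_fiberwise_of_maps_to (fun e _ => mem_univ (α.index e)) F).symm

theorem sum_blocksFun_eq {n : ℕ} {M : Type*} [AddCommMonoid M] (α : Composition n) (F : ℕ → M) :
    ∑ p, F (α.blocksFun p) = (α.blocks.map F).sum := by
  rw [← List.sum_ofFn, ← α.ofFn_blocksFun, List.map_ofFn]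
  rfl

theorem card_blocksFun_index_eq {n : ℕ} (α : Composition n) (a : ℕ) :
    #{e | #(fiberOf α.index e) = a} = a * α.blocks.count a := by
  rw [Finset.card_filter, sum_index α]
  have h : ∀ p, (∑ e with α.index e = p, if #(fiberOf α.index e) = a then 1 else 0) =
      (fun k => if k = a then a else 0) (α.blocksFun p) := by
    intro p
    rw [Finset.sum_congr rfl (g := fun _ => if α.blocksFun p = a then 1 else 0) fun e he => by
      rw [card_fiberOf_index, (mem_filter.mp he).2], Finset.sum_const, card_filter_index_eq]
    split_ifs with h <;> simp [h]
  rw [Finset.sum_congr rfl fun p _ => h p, sum_blocksFun_eq α fun k => if k = a then a else 0]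
  induction α.blocks with
  | nil => simp
  | cons k l ih =>
    rw [List.map_cons, List.sum_cons, ih, List.count_cons]
    split_ifs with h1 h2 h2
    · ring
    · simp [h1] at h2
    · simp at h2
      exact absurd h2 h1
    · ring

theorem qcoeff_zero_powerDer_rankTwo {n : ℕ} {α : Composition n} (hα : 2 ≤ α.length) {a b : ℕ}
    (hab : a + b = n) :
    qcoeff 0 (powerDer b (powerDer a (matroidQSym (rankTwoMatroid α)))) =
      (-1) ^ n * (a * b) * α.blocks.count a := by
  have h := congrArg (fun f => qcoeff 0 (powerDer b (powerDer a f))) (two_nsmul_matroidQSym hα)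
  simp only [map_nsmul, map_sum] at h
  rw [sum_crossPairs_powerDer α.index (by rw [Fintype.card_fin]; exact hab), Fintype.card_fin,
    card_blocksFun_index_eq, nsmul_eq_mul] at h
  push_cast at h
  linarith

theorem bracketFunctional_rankTwo {n : ℕ} {α : Composition n} (hα : 2 ≤ α.length) {a b : ℕ}
    (hab : a + b = n) :
    bracketFunctional a b (matroidQSym (rankTwoMatroid α)) =
      (-1) ^ n * (a * b) * (α.blocks.count a - α.blocks.count b) := by
  rw [bracketFunctional_apply, qcoeff_zero_powerDer_rankTwo hα hab,
    qcoeff_zero_powerDer_rankTwo hα ((add_comm b a).trans hab)]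
  ring

/-! ### Splitting the function of a rank two matroid into contributions of parallelism classes -/

section Blocks

variable {E : Type*}

theorem IsOrderInvariant.mono {U V : Finset E} (hUV : U ⊆ V) {h : (E → ℕ) → ℚ}
    (hh : IsOrderInvariant U h) : IsOrderInvariant V h :=
  fun f g hfg => hh f g fun x hx y hy => hfg x (hUV hx) y (hUV hy)

theorem IsOrderInvariant.mul {U : Finset E} {h k : (E → ℕ) → ℚ}
    (hh : IsOrderInvariant U h) (hk : IsOrderInvariant U k) :
    IsOrderInvariant U fun f => h f * k f := by
  intro f g hfg
  simp only [hh f g hfg, hk f g hfg]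

/-- The weight `1`, `1/2` or `0` according to whether `a < b`, `a = b` or `a > b`. -/
def compareWeight (a b : ℕ) : ℚ := if a < b then 1 else if b < a then 0 else 1 / 2

theorem compareWeight_add (a b : ℕ) : compareWeight a b + compareWeight b a = 1 := by
  unfold compareWeight
  rcases lt_trichotomy a b with h | rfl | h
  · simp [h, h.not_gt]
  · norm_num
  · simp [h, h.not_gt]

variable [Fintype E]

theorem isOrderInvariant_compareWeight (e e' : E) :
    IsOrderInvariant univ fun f => compareWeight (f e) (f e') := by
  intro f g hfg
  simp only [compareWeight, hfg e (mem_univ _) e' (mem_univ _), hfg e' (mem_univ _) e (mem_univ _)]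

variable [DecidableEq E]

/-- The relation making `e` smaller than everything else. -/
def starRel (e x y : E) : Prop := x = e ∧ y ≠ e

theorem strictIndicator_starRel_eq_one {C : Finset E} {e : E} (he : e ∈ C) {f : E → ℕ}
    (h : ∀ y ∈ C, y ≠ e → f e < f y) : strictIndicator (starRel e) C f = 1 := by
  refine if_pos ?_
  rintro x _ y hy ⟨rfl, hne⟩
  exact h y hy hne

theorem strictIndicator_starRel_eq_zero {C : Finset E} {e : E} (he : e ∈ C) {f : E → ℕ}
    (h : ¬ ∀ y ∈ C, y ≠ e → f e < f y) : strictIndicator (starRel e) C f = 0 :=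
  if_neg fun H => h fun y hy hne => H e he y hy ⟨rfl, hne⟩

/-- The indicator of the maps with a strict minimum on `C` at `e` and on the complement of `C`
at `e'`. -/
def splitIndicator (C : Finset E) (e e' : E) (f : E → ℕ) : ℚ :=
  strictIndicator (starRel e) C f * strictIndicator (starRel e') Cᶜ f

theorem isOrderInvariant_splitIndicator (C : Finset E) (e e' : E) :
    IsOrderInvariant univ (splitIndicator C e e') :=
  ((isOrderInvariant_strictIndicator _ _).mono (subset_univ _)).mul
    ((isOrderInvariant_strictIndicator _ _).mono (subset_univ _))

/-- The maps with strict minima on `C` at `e` and on the complement of `C` at `e'`, weighted by the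
comparison of these minima. -/
def splitQSym (C : Finset E) (e e' : E) : QSym :=
  genQSym univ (fun f => compareWeight (f e) (f e') * splitIndicator C e e' f)
    ((isOrderInvariant_compareWeight e e').mul (isOrderInvariant_splitIndicator C e e'))

/-- The contribution of a parallelism class `C` to the function of a rank two matroid. -/
def classQSym (C : Finset E) : QSym := ∑ e ∈ C, ∑ e' ∈ Cᶜ, splitQSym C e e'

/-- An element outside both classes has to exceed f(e) and f(e'); when f(e) ≤ f(e') the first
condition is redundant, and what remains are independent conditions on the class of e and on its
complement. -/
theorem strictIndicator_pairRel {ι : Type*} [DecidableEq ι] {c : E → ι} {e e' : E}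
    (hne : c e ≠ c e') {f : E → ℕ} (hle : f e ≤ f e') :
    strictIndicator (pairRel c e e') univ f = splitIndicator (fiberOf c e) e e' f := by
  have he : e ∈ fiberOf c e := mem_fiberOf.mpr rfl
  have he' : e' ∈ (fiberOf c e)ᶜ := by
    rw [mem_compl, mem_fiberOf]
    exact hne.symm
  unfold splitIndicator
  by_cases h1 : ∀ y ∈ fiberOf c e, y ≠ e → f e < f y
  · by_cases h2 : ∀ y ∈ (fiberOf c e)ᶜ, y ≠ e' → f e' < f y
    · rw [strictIndicator_starRel_eq_one he h1, strictIndicator_starRel_eq_one he' h2, one_mul]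
      refine if_pos ?_
      rintro x - y - ⟨hy, hy', ⟨rfl, h⟩ | ⟨rfl, h⟩⟩
      · by_cases hc : c y = c x
        · exact h1 y (mem_fiberOf.mpr hc) hy
        · exact hle.trans_lt (h2 y (by rwa [mem_compl, mem_fiberOf]) hy')
      · exact h2 y (by rwa [mem_compl, mem_fiberOf]) hy'
    · rw [strictIndicator_starRel_eq_zero he' h2, mul_zero]
      refine if_neg fun H => h2 fun y hy hye' => ?_
      rw [mem_compl, mem_fiberOf] at hy
      exact H e' (mem_univ _) y (mem_univ _) ⟨fun h => hy (congrArg c h), hye', Or.inr ⟨rfl, hy⟩⟩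
  · rw [strictIndicator_starRel_eq_zero he h1, zero_mul]
    refine if_neg fun H => h1 fun y hy hye => ?_
    rw [mem_fiberOf] at hy
    exact H e (mem_univ _) y (mem_univ _)
      ⟨hye, fun h => hne (by rw [← hy, h]), Or.inl ⟨rfl, by rwa [hy]⟩⟩

/-- If f(e) ≠ f(e'), only the term of the smaller one counts. If they are equal, both splittings
describe the same maps and contribute one half each. -/
theorem strictQSym_pairRel {ι : Type*} [DecidableEq ι] {c : E → ι} {e e' : E} (hne : c e ≠ c e') :
    strictQSym (pairRel c e e') univ =
      splitQSym (fiberOf c e) e e' + splitQSym (fiberOf c e') e' e := by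
  apply ext_qcoeff
  intro d
  rw [map_add, strictQSym, splitQSym, splitQSym, qcoeff_genQSym, qcoeff_genQSym, qcoeff_genQSym,
    ← Finset.sum_add_distrib]
  refine Finset.sum_congr rfl fun f _ => ?_
  have h1 := strictIndicator_pairRel hne (f := f)
  have h2 := strictIndicator_pairRel hne.symm (f := f)
  rw [pairRel_comm] at h2
  unfold compareWeight
  rcases lt_trichotomy (f e) (f e') with h | h | h
  · rw [h1 h.le]
    simp [h, h.not_gt]
  · rw [← h1 h.le, ← h2 h.ge]
    simp only [h, lt_irrefl, if_false]
    ring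
  · rw [h2 h.le]
    simp [h, h.not_gt]

/-- The two comparison weights of the minima add up to 1, so all coupling between C and its
complement disappears and the generating function factors. -/
theorem classQSym_add_compl (C : Finset E) :
    classQSym C + classQSym Cᶜ =
      (∑ e ∈ C, strictQSym (starRel e) C) * ∑ e' ∈ Cᶜ, strictQSym (starRel e') Cᶜ := by
  rw [classQSym, classQSym, compl_compl, Finset.sum_comm (s := Cᶜ), ← Finset.sum_add_distrib,
    Finset.sum_mul_sum]
  refine Finset.sum_congr rfl fun e _ => ?_
  rw [← Finset.sum_add_distrib]
  refine Finset.sum_congr rfl fun e' _ => ?_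
  have hU : C ∪ Cᶜ = univ := union_compl C
  rw [strictQSym, strictQSym, genQSym_mul disjoint_compl_right _ _
    (hU ▸ isOrderInvariant_splitIndicator C e e')]
  apply ext_qcoeff
  intro d
  rw [map_add, splitQSym, splitQSym, qcoeff_genQSym, qcoeff_genQSym, qcoeff_genQSym, hU,
    ← Finset.sum_add_distrib]
  refine Finset.sum_congr rfl fun f _ => ?_
  have hsymm : splitIndicator Cᶜ e' e f = splitIndicator C e e' f := by
    unfold splitIndicator
    rw [compl_compl, mul_comm]
  rw [hsymm, ← add_mul, compareWeight_add, one_mul]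
  rfl

theorem classQSym_add_compl_mem (C : Finset E) (hC : C.Nonempty) (hC' : Cᶜ.Nonempty) :
    classQSym C + classQSym Cᶜ ∈ maxIdeal ^ 2 := by
  rw [classQSym_add_compl, pow_two]
  exact Ideal.mul_mem_mul (Ideal.sum_mem _ fun e _ => genQSym_mem_maxIdeal hC _)
    (Ideal.sum_mem _ fun e _ => genQSym_mem_maxIdeal hC' _)

theorem strictIndicator_starRel_map (σ : Equiv.Perm E) (C : Finset E) (e : E) (f : E → ℕ) :
    strictIndicator (starRel (σ e)) (C.map σ.toEmbedding) f =
      strictIndicator (starRel e) C (f ∘ σ) := by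
  unfold strictIndicator starRel
  congr 1
  rw [eq_iff_iff]
  simp only [Finset.forall_mem_map, Equiv.coe_toEmbedding, EmbeddingLike.apply_eq_iff_eq,
    Function.comp_apply, ne_eq]

theorem map_compl_equiv (σ : Equiv.Perm E) (C : Finset E) :
    (C.map σ.toEmbedding)ᶜ = Cᶜ.map σ.toEmbedding := by
  ext x
  simp

theorem splitQSym_map (σ : Equiv.Perm E) (C : Finset E) (e e' : E) :
    splitQSym (C.map σ.toEmbedding) (σ e) (σ e') = splitQSym C e e' := by
  apply ext_qcoeff
  intro d
  rw [splitQSym, splitQSym, qcoeff_genQSym, qcoeff_genQSym]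
  refine Finset.sum_nbij' (fun f => f ∘ σ) (fun f => f ∘ σ.symm) ?_ ?_ ?_ ?_ ?_
  · intro f hf
    rw [mem_mapsOfWeight] at hf ⊢
    refine ⟨by simp, hf.2 ▸ ?_⟩
    exact Equiv.sum_comp σ fun x => Finsupp.single (f x) 1
  · intro f hf
    rw [mem_mapsOfWeight] at hf ⊢
    refine ⟨by simp, hf.2 ▸ ?_⟩
    exact Equiv.sum_comp σ.symm fun x => Finsupp.single (f x) 1
  · intro f _
    funext x
    simp
  · intro f _
    funext x
    simp
  · intro f _
    unfold splitIndicator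
    rw [map_compl_equiv, strictIndicator_starRel_map, strictIndicator_starRel_map]
    rfl

theorem classQSym_map (σ : Equiv.Perm E) (C : Finset E) :
    classQSym (C.map σ.toEmbedding) = classQSym C := by
  rw [classQSym, classQSym, map_compl_equiv, Finset.sum_map]
  refine Finset.sum_congr rfl fun e _ => ?_
  rw [Finset.sum_map]
  exact Finset.sum_congr rfl fun e' _ => splitQSym_map σ C e e'

/-- A bijection from C to D extends to a permutation of the ground set, and relabeling elements does
not change the generating function. -/
theorem classQSym_eq_of_card_eq {C D : Finset E} (h : #C = #D) : classQSym C = classQSym D := by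
  let τ := Finset.equivOfCardEq h
  have hmap : C.map τ.extendSubtype.toEmbedding = D := by
    refine Finset.eq_of_subset_of_card_le ?_ (by rw [card_map, h])
    intro x hx
    obtain ⟨y, hy, rfl⟩ := Finset.mem_map.mp hx
    exact τ.extendSubtype_mem y hy
  rw [← hmap, classQSym_map]

end Blocks

theorem matroidQSym_rankTwo {n : ℕ} {α : Composition n} (hα : 2 ≤ α.length) :
    matroidQSym (rankTwoMatroid α) = ∑ p, classQSym ({e | α.index e = p} : Finset (Fin n)) := by
  have h := two_nsmul_matroidQSym hα
  rw [Finset.sum_congr rfl fun p hp => strictQSym_pairRel (mem_crossPairs.mp hp),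
    Finset.sum_add_distrib] at h
  have hswap := sum_crossPairs_swap α.index fun p => splitQSym (fiberOf α.index p.1) p.1 p.2
  simp only [Prod.fst_swap, Prod.snd_swap] at hswap
  -- By symmetry the contributions of first and second entries agree; the resulting factor 2 cancels
  -- the double counting of bases, as QSym is a ℚ-vector space.
  rw [hswap, ← two_nsmul, ← Nat.cast_smul_eq_nsmul ℚ, ← Nat.cast_smul_eq_nsmul ℚ] at h
  rw [smul_right_injective QSym (r := ((2 : ℕ) : ℚ)) (by norm_num) h, sum_crossPairs, sum_index α]
  refine Finset.sum_congr rfl fun p _ => ?_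
  rw [classQSym]
  refine Finset.sum_congr rfl fun e he => ?_
  have hp : α.index e = p := (mem_filter.mp he).2
  subst hp
  refine Finset.sum_congr ?_ fun e' _ => rfl
  ext x
  simp

/-- The image modulo `𝔪²` of the contribution of a parallelism class of size `a`. -/
def classMod (n a : ℕ) : QSym ⧸ maxIdeal ^ 2 :=
  Ideal.Quotient.mk (maxIdeal ^ 2) (classQSym ({x | (x : ℕ) < a} : Finset (Fin n)))

theorem mk_classQSym {n : ℕ} (C : Finset (Fin n)) :
    Ideal.Quotient.mk (maxIdeal ^ 2) (classQSym C) = classMod n #C := by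
  have hC : #C ≤ n := by simpa using card_le_univ C
  rw [classMod, classQSym_eq_of_card_eq (D := ({x | (x : ℕ) < #C} : Finset (Fin n)))]
  rw [Fin.card_filter_val_lt, min_eq_right hC]

theorem classMod_add_classMod {n a b : ℕ} (ha : 0 < a) (hb : 0 < b) (hab : a + b = n) :
    classMod n a + classMod n b = 0 := by
  set C : Finset (Fin n) := {x | (x : ℕ) < a} with hCdef
  have hC : #C = a := by
    rw [hCdef, Fin.card_filter_val_lt, min_eq_right]
    omega
  have hC' : #Cᶜ = b := by
    rw [card_compl, Fintype.card_fin]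
    omega
  rw [← hC, ← hC', ← mk_classQSym, ← mk_classQSym, ← map_add, Ideal.Quotient.eq_zero_iff_mem]
  exact classQSym_add_compl_mem C (card_pos.mp (by omega)) (card_pos.mp (by omega))

theorem partitionComposition_length {n : ℕ} (p : n.Partition) :
    (partitionComposition p).length = p.parts.card := by
  rw [← Composition.blocks_length]
  simp [partitionComposition]

theorem coe_partitionComposition_blocks {n : ℕ} (p : n.Partition) :
    ((partitionComposition p).blocks : Multiset ℕ) = p.parts :=
  Multiset.sort_eq _ _

theorem partitionQSymMod_eq {n : ℕ} (p : n.Partition) (hp : 2 ≤ p.parts.card) :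
    partitionQSymMod p = (p.parts.map (classMod n)).sum := by
  rw [partitionQSymMod, matroidQSym_rankTwo (by rwa [partitionComposition_length]), map_sum]
  simp only [mk_classQSym, card_filter_index_eq]
  rw [sum_blocksFun_eq (partitionComposition p) (classMod n), ← coe_partitionComposition_blocks p,
    Multiset.map_coe, Multiset.sum_coe]

/-! ### Partitions with three parts generate -/

/-- Merging two parts a and b costs one generator: modulo 𝔪² the sum for {a, b} ∪ t equals the sum
for {a, b, Σt} plus the sum for {a + b} ∪ t, because c(a + b) + c(Σt) = 0. The number of parts drops
by one and stays at least 3. -/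
theorem sum_classMod_mem_closure {n : ℕ} (s : Multiset ℕ) (hpos : ∀ a ∈ s, 0 < a) (hsum : s.sum = n)
    (hcard : 3 ≤ s.card) :
    (s.map (classMod n)).sum ∈ AddSubsemigroup.closure
      (partitionQSymMod '' {p : n.Partition | p.parts.card = 3}) := by
  have h3 : ∀ s : Multiset ℕ, (∀ a ∈ s, 0 < a) → s.sum = n → s.card = 3 →
      (s.map (classMod n)).sum ∈ AddSubsemigroup.closure
        (partitionQSymMod '' {p : n.Partition | p.parts.card = 3}) := by
    intro s hpos hsum hcard
    have := partitionQSymMod_eq (⟨s, fun {i} hi => hpos i hi, hsum⟩ : n.Partition)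
      (by simp [hcard])
    rw [← this]
    exact AddSubsemigroup.subset_closure ⟨_, hcard, rfl⟩
  induction k : s.card using Nat.strong_induction_on generalizing s with
  | _ k ih =>
    subst k
    rcases hcard.eq_or_lt with h | h
    · exact h3 s hpos hsum h.symm
    · obtain ⟨a, has⟩ := Multiset.card_pos_iff_exists_mem.mp (by omega : 0 < s.card)
      obtain ⟨t, rfl⟩ := Multiset.exists_cons_of_mem has
      rw [Multiset.card_cons] at h
      obtain ⟨b, hbt⟩ := Multiset.card_pos_iff_exists_mem.mp (by omega : 0 < t.card)
      obtain ⟨t, rfl⟩ := Multiset.exists_cons_of_mem hbt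
      rw [Multiset.card_cons] at h
      have ha : 0 < a := hpos a (by simp)
      have hb : 0 < b := hpos b (by simp)
      have ht : ∀ x ∈ t, 0 < x := fun x hx => hpos x (by simp [hx])
      have hts : 0 < t.sum := by
        obtain ⟨x, hx⟩ := Multiset.card_pos_iff_exists_mem.mp (by omega : 0 < t.card)
        exact (ht x hx).trans_le (Multiset.le_sum_of_mem hx)
      simp only [Multiset.sum_cons] at hsum
      have e1 := h3 {a, b, t.sum}
        (by
          simp only [Multiset.insert_eq_cons, Multiset.mem_cons, Multiset.mem_singleton]
          rintro x (rfl | rfl | rfl) <;> assumption)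
        (by simp [← hsum]) (by simp)
      have e2 := ih _ (by simp) ((a + b) ::ₘ t)
        (by
          simp only [Multiset.mem_cons]
          rintro x (rfl | hx)
          · omega
          · exact ht x hx)
        (by simp only [Multiset.sum_cons]; omega) (by rw [Multiset.card_cons]; omega) rfl
      have e3 := add_mem e1 e2
      have h0 := classMod_add_classMod (n := n) (a := a + b) (b := t.sum) (by omega) hts (by omega)
      convert e3 using 1
      simp only [Multiset.insert_eq_cons, Multiset.map_cons, Multiset.sum_cons,
        Multiset.map_singleton, Multiset.sum_singleton]
      calc _ = classMod n a + (classMod n b + (t.map (classMod n)).sum) +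
            (classMod n (a + b) + classMod n t.sum) := by rw [h0, add_zero]
        _ = _ := by abel

theorem partitionQSymMod_mem_closure {n : ℕ} (p : n.Partition) (hp : 3 ≤ p.parts.card) :
    partitionQSymMod p ∈ AddSubsemigroup.closure
      (partitionQSymMod '' {p : n.Partition | p.parts.card = 3}) := by
  rw [partitionQSymMod_eq p (by omega)]
  exact sum_classMod_mem_closure _ (fun a ha => p.parts_pos ha) p.parts_sum hp

/-! ### Functionals on the indecomposables -/

/-- The functional induced by a commutator of derivations on `QSym / 𝔪²`. -/
def bracketMod (a b : ℕ) : QSym ⧸ maxIdeal ^ 2 →+ ℚ :=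
  QuotientAddGroup.lift (maxIdeal ^ 2).toAddSubgroup (bracketFunctional a b).toAddMonoidHom
    fun _ hf => bracketFunctional_eq_zero a b hf

theorem bracketMod_mk (a b : ℕ) (f : QSym) :
    bracketMod a b (Ideal.Quotient.mk (maxIdeal ^ 2) f) = bracketFunctional a b f := rfl

theorem bracketMod_partitionQSymMod {n : ℕ} (p : n.Partition) (hp : 2 ≤ p.parts.card) {a b : ℕ}
    (hab : a + b = n) :
    bracketMod a b (partitionQSymMod p) =
      (-1) ^ n * (a * b) * (p.parts.count a - p.parts.count b) := by
  rw [partitionQSymMod, bracketMod_mk,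
    bracketFunctional_rankTwo (by rwa [partitionComposition_length]) hab,
    ← coe_partitionComposition_blocks p, Multiset.coe_count, Multiset.coe_count]

theorem lt_of_mem_parts {n : ℕ} (p : n.Partition) (hp : 2 ≤ p.parts.card) {a : ℕ}
    (ha : a ∈ p.parts) : a < n := by
  obtain ⟨t, ht⟩ := Multiset.exists_cons_of_mem ha
  have hsum := p.parts_sum
  have hpos : ∀ x ∈ p.parts, 0 < x := fun x hx => p.parts_pos hx
  rw [ht] at hp hsum hpos
  rw [Multiset.card_cons] at hp
  obtain ⟨x, hx⟩ := Multiset.card_pos_iff_exists_mem.mp (by omega : 0 < t.card)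
  have := hpos x (by simp [hx])
  have := Multiset.le_sum_of_mem hx
  rw [Multiset.sum_cons] at hsum
  omega

theorem sum_count_mul_eq {n : ℕ} (p : n.Partition) (hp : 2 ≤ p.parts.card) (g : ℕ → ℚ) :
    ∑ a ∈ Ioo 0 n, p.parts.count a * g a = (p.parts.map g).sum := by
  rw [Finset.sum_multiset_map_count]
  symm
  simp only [nsmul_eq_mul]
  refine Finset.sum_subset (fun a ha => ?_) fun a _ ha => ?_
  · rw [Multiset.mem_toFinset] at ha
    exact mem_Ioo.mpr ⟨p.parts_pos ha, lt_of_mem_parts p hp ha⟩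
  · rw [Multiset.mem_toFinset] at ha
    rw [Multiset.count_eq_zero.mpr ha, Nat.cast_zero, zero_mul]

/-- The functional which takes the value `ℓ(λ) - 2` on the class of `F(M_λ)`. -/
def excess (n : ℕ) : QSym ⧸ maxIdeal ^ 2 →+ ℚ :=
  -- Dividing by (-1)^n a(n - a) normalizes the commutator to m_a - m_{n-a}. The weight (n - 2a)/n
  -- is odd under a ↦ n - a, so half the weighted sum of these differences is Σ m_a (n - 2a)/n =
  -- ℓ(λ) - 2.
  ∑ a ∈ Ioo 0 n, ((-1 : ℚ) ^ n * (n - 2 * a) / (2 * n * (a * (n - a : ℕ)))) • bracketMod a (n - a)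

theorem excess_partitionQSymMod {n : ℕ} (p : n.Partition) (hp : 2 ≤ p.parts.card) :
    excess n (partitionQSymMod p) = p.parts.card - 2 := by
  have hn : 0 < n := by
    obtain ⟨x, hx⟩ := Multiset.card_pos_iff_exists_mem.mp (by omega : 0 < p.parts.card)
    exact (Nat.zero_le x).trans_lt (lt_of_mem_parts p hp hx)
  have hn' : (n : ℚ) ≠ 0 := by positivity
  have hterm : ∀ a ∈ Ioo 0 n,
      ((-1 : ℚ) ^ n * (n - 2 * a) / (2 * n * (a * (n - a : ℕ)))) *
        bracketMod a (n - a) (partitionQSymMod p) =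
      p.parts.count a * ((n - 2 * a) / (2 * n)) -
        p.parts.count (n - a) * ((n - 2 * a) / (2 * n)) := by
    intro a ha
    rw [mem_Ioo] at ha
    rw [bracketMod_partitionQSymMod p hp (by omega : a + (n - a) = n)]
    have h1 : (a : ℚ) ≠ 0 := Nat.cast_ne_zero.mpr (by omega)
    have h2 : ((n - a : ℕ) : ℚ) ≠ 0 := Nat.cast_ne_zero.mpr (by omega)
    have h3 : ((-1 : ℚ) ^ n) * (-1) ^ n = 1 := by rw [← mul_pow]; norm_num
    field_simp
    linear_combination ((n - 2 * a) * (p.parts.count a - p.parts.count (n - a)) : ℚ) * h3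
  have hreflect : ∑ a ∈ Ioo 0 n, (p.parts.count (n - a) : ℚ) * ((n - 2 * a) / (2 * n)) =
      ∑ a ∈ Ioo 0 n, (p.parts.count a : ℚ) * -((n - 2 * a) / (2 * n)) := by
    refine Finset.sum_nbij' (fun a => n - a) (fun a => n - a) ?_ ?_ ?_ ?_ ?_
    · intro a ha; rw [mem_Ioo] at ha ⊢; omega
    · intro a ha; rw [mem_Ioo] at ha ⊢; omega
    · intro a ha; rw [mem_Ioo] at ha; omega
    · intro a ha; rw [mem_Ioo] at ha; omega
    · intro a ha
      rw [mem_Ioo] at ha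
      rw [Nat.cast_sub ha.2.le]
      ring
  have hlin : ∀ s : Multiset ℕ, (s.map fun a : ℕ => ((n - 2 * (a : ℚ)) / n : ℚ)).sum =
      (n * s.card - 2 * s.sum) / n := by
    intro s
    induction s using Multiset.induction with
    | empty => simp
    | cons a s ih =>
      rw [Multiset.map_cons, Multiset.sum_cons, ih, Multiset.card_cons, Multiset.sum_cons]
      push_cast
      ring
  rw [excess, AddMonoidHom.finsetSum_apply]
  simp only [AddMonoidHom.smul_apply, smul_eq_mul]
  rw [Finset.sum_congr rfl hterm, Finset.sum_sub_distrib, hreflect, ← Finset.sum_sub_distrib,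
    Finset.sum_congr rfl (g := fun a => (p.parts.count a : ℚ) * ((n - 2 * a) / n)),
    sum_count_mul_eq p hp, hlin, p.parts_sum]
  · field_simp
  · intro a _
    field_simp
    ring

/-- Parts a and b would already exhaust n and leave no room for a third part. -/
theorem count_eq_zero_or {n : ℕ} (p : n.Partition) (hp : 3 ≤ p.parts.card) {a b : ℕ}
    (hab : a + b = n) (hne : a ≠ b) : p.parts.count a = 0 ∨ p.parts.count b = 0 := by
  rw [Multiset.count_eq_zero, Multiset.count_eq_zero]
  by_contra! h
  obtain ⟨t, ht⟩ := Multiset.exists_cons_of_mem h.1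
  have hb := h.2
  have hsum := p.parts_sum
  have hpos : ∀ x ∈ p.parts, 0 < x := fun x hx => p.parts_pos hx
  rw [ht] at hb hsum hpos hp
  obtain ⟨u, rfl⟩ := Multiset.exists_cons_of_mem
    ((Multiset.mem_cons.mp hb).resolve_left hne.symm)
  simp only [Multiset.sum_cons, Multiset.card_cons] at hsum hp
  obtain ⟨x, hx⟩ := Multiset.card_pos_iff_exists_mem.mp (by omega : 0 < u.card)
  have := hpos x (by simp [hx])
  have := Multiset.le_sum_of_mem hx
  omega

/-- For a ≠ n/2 at most one of m_a, m_{n-a} is nonzero, so their difference determines both. -/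
theorem partitionQSymMod_injOn (n : ℕ) :
    Set.InjOn partitionQSymMod {p : n.Partition | p.parts.card = 3} := by
  intro p hp q hq h
  replace hp : p.parts.card = 3 := hp
  replace hq : q.parts.card = 3 := hq
  have hcount : ∀ a, 2 * a ≠ n → p.parts.count a = q.parts.count a := by
    intro a ha
    by_cases h0 : 0 < a ∧ a < n
    · have hab : a + (n - a) = n := by omega
      have hb := congrArg (bracketMod a (n - a)) h
      rw [bracketMod_partitionQSymMod p (by omega) hab,
        bracketMod_partitionQSymMod q (by omega) hab] at hb
      have h1 : (a : ℚ) ≠ 0 := Nat.cast_ne_zero.mpr (by omega)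
      have h2 : ((n - a : ℕ) : ℚ) ≠ 0 := Nat.cast_ne_zero.mpr (by omega)
      have h3 : ((-1 : ℚ) ^ n) ≠ 0 := pow_ne_zero _ (by norm_num)
      have hb := mul_left_cancel₀ (mul_ne_zero h3 (mul_ne_zero h1 h2)) hb
      have hb' : (p.parts.count a : ℤ) - p.parts.count (n - a) =
          q.parts.count a - q.parts.count (n - a) := by exact_mod_cast hb
      have := count_eq_zero_or p hp.ge hab (by omega)
      have := count_eq_zero_or q hq.ge hab (by omega)
      omega
    · rw [Multiset.count_eq_zero.mpr, Multiset.count_eq_zero.mpr]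
      · exact fun hm => h0 ⟨q.parts_pos hm, lt_of_mem_parts q (by omega) hm⟩
      · exact fun hm => h0 ⟨p.parts_pos hm, lt_of_mem_parts p (by omega) hm⟩
  have hfilter : p.parts.filter (fun a => ¬ n = 2 * a) = q.parts.filter fun a => ¬ n = 2 * a := by
    ext a
    rw [Multiset.count_filter, Multiset.count_filter]
    split_ifs with ha
    · rfl
    · exact hcount a fun h' => ha h'.symm
  -- The commutators do not see the multiplicity of n/2; it is what the other parts leave of the
  -- total of three.
  have hcard : ∀ s : Multiset ℕ, s.card =
      (s.filter fun a => n = 2 * a).card + (s.filter fun a => ¬ n = 2 * a).card := by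
    intro s
    rw [← Multiset.card_add, Multiset.filter_add_not]
  apply Nat.Partition.ext
  ext a
  by_cases ha : 2 * a = n
  · have hc : ∀ s : Multiset ℕ, s.count a = (s.filter fun b => n = 2 * b).card := by
      intro s
      rw [Multiset.count, Multiset.countP_eq_card_filter]
      congr 1
      refine Multiset.filter_congr fun x _ => ?_
      omega
    rw [hc, hc]
    have h1 := hcard p.parts
    have h2 := hcard q.parts
    rw [hfilter] at h1
    omega
  · exact hcount a ha

/-! ### Hilbert bases and degree functionals -/

/-- All elements of the semigroup have degree at least 1, so a sum of two has degree at least 2 and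
an element of degree 1 must be in any generating set. -/
theorem isHilbertBasis_of_degree {G : Type*} [AddCommMonoid G] {S T : Set G} (hTS : T ⊆ S)
    (hST : S ⊆ AddSubsemigroup.closure T) (w : G →+ ℚ) (hw : ∀ x ∈ T, w x = 1) :
    IsHilbertBasis (AddSubsemigroup.closure S) T := by
  have hcl : AddSubsemigroup.closure T = AddSubsemigroup.closure S :=
    le_antisymm (AddSubsemigroup.closure_mono hTS) (AddSubsemigroup.closure_le.mpr hST)
  have hge : ∀ x ∈ AddSubsemigroup.closure T, 1 ≤ w x := by
    intro x hx
    induction hx using AddSubsemigroup.closure_induction with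
    | mem x hx => exact (hw x hx).ge
    | add x y _ _ hx hy => rw [map_add]; linarith
  refine ⟨hcl, fun B hB x hx => ?_⟩
  replace hB : AddSubsemigroup.closure B = AddSubsemigroup.closure S := hB
  rw [← hcl] at hB
  have key : ∀ y ∈ AddSubsemigroup.closure B, w y = 1 → y ∈ B := by
    intro y hy
    induction hy using AddSubsemigroup.closure_induction with
    | mem y hy => exact fun _ => hy
    | add y z hy hz _ _ =>
      intro h
      have := hge y (hB ▸ hy)
      have := hge z (hB ▸ hz)
      rw [map_add] at h
      linarith
  exact key x (hB ▸ AddSubsemigroup.subset_closure hx) (hw x hx)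

/-- The same degree argument, with zero as the only element of degree below 1: in a decomposition of
an element of degree 1 one summand is zero and can be dropped. -/
theorem isMonoidHilbertBasis_of_degree {G : Type*} [AddCommMonoid G] {S T : Set G} (hTS : T ⊆ S)
    (hST : S ⊆ AddSubmonoid.closure T) (w : G →+ ℚ) (hw : ∀ x ∈ T, w x = 1) :
    IsMonoidHilbertBasis (AddSubmonoid.closure S) T := by
  have hcl : AddSubmonoid.closure T = AddSubmonoid.closure S :=
    le_antisymm (AddSubmonoid.closure_mono hTS) (AddSubmonoid.closure_le.mpr hST)
  have hge : ∀ x ∈ AddSubmonoid.closure T, x = 0 ∨ 1 ≤ w x := by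
    intro x hx
    induction hx using AddSubmonoid.closure_induction with
    | mem x hx => exact Or.inr (hw x hx).ge
    | zero => exact Or.inl rfl
    | add x y _ _ hx hy =>
      rcases hx with rfl | hx
      · rwa [zero_add]
      · rcases hy with rfl | hy
        · rw [add_zero]; exact Or.inr hx
        · right; rw [map_add]; linarith
  refine ⟨hcl, fun B hB x hx => ?_⟩
  replace hB : AddSubmonoid.closure B = AddSubmonoid.closure S := hB
  rw [← hcl] at hB
  have key : ∀ y ∈ AddSubmonoid.closure B, w y = 1 → y ∈ B := by
    intro y hy
    induction hy using AddSubmonoid.closure_induction with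
    | mem y hy => exact fun _ => hy
    | zero => simp
    | add y z hy hz ihy ihz =>
      intro h
      rcases hge y (hB ▸ hy) with rfl | h1
      · rw [zero_add] at h ⊢
        exact ihz h
      · rcases hge z (hB ▸ hz) with rfl | h2
        · rw [add_zero] at h ⊢
          exact ihy h
        · rw [map_add] at h
          linarith
  exact key x (hB ▸ AddSubmonoid.subset_closure hx) (hw x hx)

end QuasiSym

end

/-! ### The Hilbert basis of the semigroup of rank two matroids -/

theorem corollary6p7 (n : ℕ) :
    QuasiSym.IsHilbertBasis
      (AddSubsemigroup.closure
        (QuasiSym.partitionQSymMod '' {p : n.Partition | 3 ≤ p.parts.card}))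
      (QuasiSym.partitionQSymMod '' {p : n.Partition | p.parts.card = 3}) ∧
    QuasiSym.IsMonoidHilbertBasis
      (AddSubmonoid.closure
        (QuasiSym.partitionQSymMod '' {p : n.Partition | 3 ≤ p.parts.card}))
      (QuasiSym.partitionQSymMod '' {p : n.Partition | p.parts.card = 3}) ∧
    Set.InjOn QuasiSym.partitionQSymMod {p : n.Partition | p.parts.card = 3} := by
  have hTS : QuasiSym.partitionQSymMod '' {p : n.Partition | p.parts.card = 3} ⊆
      QuasiSym.partitionQSymMod '' {p : n.Partition | 3 ≤ p.parts.card} :=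
    Set.image_mono fun p (hp : p.parts.card = 3) => hp.ge
  have hST : QuasiSym.partitionQSymMod '' {p : n.Partition | 3 ≤ p.parts.card} ⊆
      AddSubsemigroup.closure
        (QuasiSym.partitionQSymMod '' {p : n.Partition | p.parts.card = 3}) := by
    rintro _ ⟨p, hp, rfl⟩
    exact QuasiSym.partitionQSymMod_mem_closure p hp
  have hw : ∀ x ∈ QuasiSym.partitionQSymMod '' {p : n.Partition | p.parts.card = 3},
      QuasiSym.excess n x = 1 := by
    rintro _ ⟨p, hp, rfl⟩
    replace hp : p.parts.card = 3 := hp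
    rw [QuasiSym.excess_partitionQSymMod p (by omega), hp]
    norm_num
  refine ⟨QuasiSym.isHilbertBasis_of_degree hTS hST _ hw,
    QuasiSym.isMonoidHilbertBasis_of_degree hTS (hST.trans ?_) _ hw,
    QuasiSym.partitionQSymMod_injOn n⟩
  exact AddSubsemigroup.closure_le (S := (AddSubmonoid.closure _).toAddSubsemigroup).mpr
    AddSubmonoid.subset_closure
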